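/- Let $p\ge 2$ be an even integer. For every $n\ge 1$ let $\mathcal S^{(1)}_n,\dots,\mathcal S^{(p)}_n$ be nonempty subsets of the unit sphere $\mathbb S^n=\{x\in\mathbb R^n:\|x\|_2=1\}$, and write $\bar{\mathcal S}=(\mathcal S^{(j)})_{1\le j\le p}$, suppressing $n$. Let $A=(A_{i_1,\dots,i_p})_{1\le i_1,\dots,i_p\le n}$ have independent standard normal entries, let $A^{(1)},\dots,A^{(p)}$ be independent copies of $A$, and let $g,g^{(1)},\dots,g^{(p)}$ be independent standard normal vectors in $\mathbb R^n$. For a $p$-tensor $B$ put $B[x^{(1)},\dots,x^{(p)}]=\sum_{i_1,\dots,i_p=1}^n B_{i_1,\dots,i_p}\prod_{j=1}^p x^{(j)}_{i_j}$. Maxima are understood as suprema (they are attained if the sets are closed). Set $$\xi_n=\frac1{\sqrt n}\,\mathbb E\max_{x^{(j)}\in\mathcal S^{(j)}}A[x^{(1)},\dots,x^{(p)}],$$ and for $c_3>0$ $$\xi_u(p;\bar{\mathcal S},n,c_3)=\frac1{\sqrt n}\Big(-\frac{c_3}2(p-1)+\frac1{c_3}\log\mathbb E\, e^{c_3\max_{x^{(j)}\in\mathcal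 S^{(j)}}\sum_{j=1}^p (g^{(j)})^Tx^{(j)}}\Big),$$ $$\xi_l(p;\bar{\mathcal S},n,c_3)=\frac1{\sqrt n}\,\frac1{c_3}\log\mathbb E\, e^{\frac{c_3}{\sqrt p}\max_{x^{(j)}\in\mathcal S^{(j)}}\sum_{j=1}^p A^{(j)}[x^{(j)},\dots,x^{(j)}]}.$$ Whenever the limit exists, $\xi(p;\bar{\mathcal S})=\lim_{n\to\infty}\xi_n$ is the multipartite ground state energy (GSE). All the expectations here and below are finite, and for every $n\ge1$ and $c_3>0$ $$\xi_u(p;\bar{\mathcal S},n,c_3)=\frac1{\sqrt n}\Big(-\frac{c_3}2(p-1)+\frac1{c_3}\sum_{j=1}^p\log\mathbb E\, e^{c_3\max_{x^{(j)}\in\mathcal S^{(j)}}(g^{(j)})^Tx^{(j)}}\Big),$$ $$\xi_l(p;\bar{\mathcal S},n,0):=\lim_{c\to0^+}\xi_l(p;\bar{\mathcal S},n,c)=\frac1{\sqrt{pn}}\,\mathbb E\max_{x^{(j)}\in\mathcal S^{(j)}}\sum_{j=1}^pA^{(j)}[x^{(j)},\dots,x^{(j)}],$$ $$\xi_l(p;\bar{\mathcal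 S},n,0)\le\xi_n\le\xi_u(p;\bar{\mathcal S},n,c_3).$$ In the thermodynamic limit, $$\lim_{n\to\infty}\xi_l(p;\bar{\mathcal S},n,0)\le\xi(p;\bar{\mathcal S})\le\min_{c_3>0}\lim_{n\to\infty}\xi_u(p;\bar{\mathcal S},n,c_3),$$ and also $\xi(p;\bar{\mathcal S})\le\inf_{c_3>0}\lim_{n\to\infty}\xi_u(p;\bar{\mathcal S},n,c_3\sqrt n)$. Each inequality is asserted whenever the limits that it contains exist (for the upper bounds: for all $c_3>0$), and the minimum is attained. Moreover, if $\mathcal S^{(j)}=\mathcal S$ for all $j$, set $$\xi_u^0(p;\mathcal S,n,c_3)=\frac{\sqrt p}{\sqrt n}\Big(-\frac{c_3}2(p-1)+\frac1{c_3}\log\mathbb E\,e^{c_3\sqrt p\max_{x\in\mathcal S}g^Tx}\Big),\qquad \xi_l^0(p;\mathcal S,n)=\frac{\sqrt p}{\sqrt n}\,\mathbb E\max_{x\in\mathcal S}A[x,\dots,x],$$ and $\xi(p;\mathcal S)=\xi(p;\bar{\mathcal S})$. Then $\xi_l^0(p;\mathcal S,n)\le\xi_n\le\xi_u^0(p;\mathcal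 S,n,c_3)$ for all $n\ge1$ and $c_3>0$, and, in the same sense as above, $$\lim_{n\to\infty}\xi_l^0(p;\mathcal S,n)\le\xi(p;\mathcal S)\le\min_{c_3>0}\lim_{n\to\infty}\xi_u^0(p;\mathcal S,n,c_3),\qquad \xi(p;\mathcal S)\le\inf_{c_3>0}\lim_{n\to\infty}\xi_u^0(p;\mathcal S,n,c_3\sqrt n).$$ Here $\lim_n\xi_l^0(p;\mathcal S,n)=\sqrt p\,\xi^0(p;\mathcal S)$, whenever the single-partite GSE $\xi^0(p;\mathcal S)=\lim_n\frac1{\sqrt n}\mathbb E\max_{x\in\mathcal S}A[x,\dots,x]$ exists, so that $\sqrt p\,\xi^0(p;\mathcal S)\le\xi(p;\mathcal S)$. -/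

import Mathlib

open MeasureTheory ProbabilityTheory Filter Topology

noncomputable section

/-- Law of a `p`-tensor of side `n` with independent standard normal entries. -/
def gaussTensor (p n : ℕ) : Measure ((Fin p → Fin n) → ℝ) :=
  Measure.pi fun _ => gaussianReal 0 1

/-- Law of `p` independent Gaussian `p`-tensors `A^(1), …, A^(p)`. -/
def gaussTensors (p n : ℕ) : Measure (Fin p → (Fin p → Fin n) → ℝ) :=
  Measure.pi fun _ => gaussTensor p n

/-- Law of a standard normal vector in `ℝⁿ`. -/
def gaussVector (n : ℕ) : Measure (Fin n → ℝ) :=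
  Measure.pi fun _ => gaussianReal 0 1

/-- Law of `p` independent standard normal vectors `g^(1), …, g^(p)`. -/
def gaussVectors (p n : ℕ) : Measure (Fin p → Fin n → ℝ) :=
  Measure.pi fun _ => gaussVector n

/-- `∑_{i₁,…,i_p} A_{i₁,…,i_p} ∏ⱼ x^(j)_{i_j}`. -/
def tensorForm {p n : ℕ} (A : (Fin p → Fin n) → ℝ)
    (x : Fin p → EuclideanSpace ℝ (Fin n)) : ℝ :=
  ∑ i : Fin p → Fin n, A i * ∏ j, x j (i j)

/- All maxima below are written as suprema: they are taken over nonempty subsets of the unit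
sphere, where the functions are bounded, and are attained when the sets are closed. -/

/-- `φ(p; S̄, n)`: maximum of the form over `x^(j) ∈ S^(j)`, `1 ≤ j ≤ p`. -/
def multiMax {p n : ℕ} (S : Fin p → Set (EuclideanSpace ℝ (Fin n)))
    (A : (Fin p → Fin n) → ℝ) : ℝ :=
  sSup ((fun x => tensorForm A x) '' Set.univ.pi S)

/-- Single-partite maximum: all `p` arguments are the same `x ∈ T`. -/
def singleMax {p n : ℕ} (T : Set (EuclideanSpace ℝ (Fin n)))
    (A : (Fin p → Fin n) → ℝ) : ℝ :=
  sSup ((fun x => tensorForm A (fun _ => x)) '' T)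

/-- `max_{x^(j) ∈ S^(j)} ∑ⱼ ∑_{i₁,…,i_p} A^(j)_{i₁,…,i_p} ∏ₖ x^(j)_{i_k}`. -/
def decoupledMax {p n : ℕ} (S : Fin p → Set (EuclideanSpace ℝ (Fin n)))
    (A : Fin p → (Fin p → Fin n) → ℝ) : ℝ :=
  sSup ((fun x : Fin p → EuclideanSpace ℝ (Fin n) =>
    ∑ j, tensorForm (A j) (fun _ => x j)) '' Set.univ.pi S)

/-- `max_{x ∈ T} gᵀx`. -/
def linearMax {n : ℕ} (T : Set (EuclideanSpace ℝ (Fin n))) (g : Fin n → ℝ) : ℝ :=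
  sSup ((fun x : EuclideanSpace ℝ (Fin n) => ∑ i, g i * x i) '' T)

/-- `max_{x^(j) ∈ S^(j)} ∑ⱼ (g^(j))ᵀ x^(j)`. -/
def linearSumMax {p n : ℕ} (S : Fin p → Set (EuclideanSpace ℝ (Fin n)))
    (g : Fin p → Fin n → ℝ) : ℝ :=
  sSup ((fun x : Fin p → EuclideanSpace ℝ (Fin n) =>
    ∑ j, ∑ i, g j i * x j i) '' Set.univ.pi S)

/-- `(1/√n) E φ(p; S̄, n)`, whose limit in `n` is the multipartite ground state energy. -/
def multiGSE {p n : ℕ} (S : Fin p → Set (EuclideanSpace ℝ (Fin n))) : ℝ :=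
  1 / √(n : ℝ) * ∫ A, multiMax S A ∂gaussTensor p n

/-- `(1/√n) E max`, whose limit in `n` is the single-partite `p`-spin ground state energy. -/
def singleGSE (p : ℕ) {n : ℕ} (T : Set (EuclideanSpace ℝ (Fin n))) : ℝ :=
  1 / √(n : ℝ) * ∫ A, singleMax T A ∂gaussTensor p n

/-- `ξ_u(p; S̄, n, c)`. -/
def xiUpper {p n : ℕ} (S : Fin p → Set (EuclideanSpace ℝ (Fin n))) (c : ℝ) : ℝ :=
  1 / √(n : ℝ) * (-(c / 2) * ((p : ℝ) - 1)
    + 1 / c * Real.log (∫ g, Real.exp (c * linearSumMax S g) ∂gaussVectors p n))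

/-- `ξ_l(p; S̄, n, c)` for `c > 0`. -/
def xiLower {p n : ℕ} (S : Fin p → Set (EuclideanSpace ℝ (Fin n))) (c : ℝ) : ℝ :=
  1 / √(n : ℝ) * (1 / c) *
    Real.log (∫ A, Real.exp ((√(p : ℝ))⁻¹ * c * decoupledMax S A) ∂gaussTensors p n)

/-- `ξ_l(p; S̄, n, 0)`, in closed form; that it is the limit of `ξ_l(p; S̄, n, c)` as `c → 0⁺`
is part of the theorem. -/
def xiLowerZero {p n : ℕ} (S : Fin p → Set (EuclideanSpace ℝ (Fin n))) : ℝ :=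
  1 / √((p : ℝ) * n) * ∫ A, decoupledMax S A ∂gaussTensors p n

/-- `ξ_u⁰(p; T, n, c)`. -/
def xiUpperIdentical (p : ℕ) {n : ℕ} (T : Set (EuclideanSpace ℝ (Fin n))) (c : ℝ) : ℝ :=
  √(p : ℝ) / √(n : ℝ) * (-(c / 2) * ((p : ℝ) - 1)
    + 1 / c * Real.log (∫ g, Real.exp (c * √(p : ℝ) * linearMax T g) ∂gaussVector n))

/-- `ξ_l⁰(p; T, n)`. -/
def xiLowerIdentical (p : ℕ) {n : ℕ} (T : Set (EuclideanSpace ℝ (Fin n))) : ℝ :=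
  √(p : ℝ) / √(n : ℝ) * ∫ A, singleMax T A ∂gaussTensor p n

end

/-! Every maximum is a supremum of linear forms in a standard Gaussian vector, so the bounds compare
Gaussian processes. With r_j = ⟨x^(j), y^(j)⟩ in [-1, 1], the covariances are ∏ r_j for the
multipartite form, ∑ r_j for the sum of linear forms, and (1/p) ∑ r_j^p for the decoupled form
divided by √p. Two inequalities decide everything: ∑ r_j - ∏ r_j ≤ p - 1 (`sum_le_prod_add`) and, by
AM-GM and evenness of p, ∏ r_j ≤ (1/p) ∑ r_j^p (`prod_le_sum_pow_div`). Both are equalities on the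
diagonal.

The analytic tool is `integral_exp_supForm_le`: if Cov b - Cov a is at most v, with equality on the
diagonal, then E exp(c sup b) ≥ exp(c²v/2) E exp(c sup a). The supremum is smoothed to β⁻¹ log ∑
exp(β z_k), a is rotated into b, and Gaussian integration by parts is applied. Up to the factor sin
θ cos θ, the derivative is an expectation weighted by cβv - c(β - c)⟨Δ⟩ ≥ c²v, where ⟨Δ⟩ is the
Gibbs average of the covariance difference. Taking v = p - 1 and then Jensen gives the upper bound;
v = 0 and c → 0 give the lower one.

For fixed c the limit of ξ_u does not depend on c, so its minimum is attained: (1/c) log E exp(c M)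
exceeds E M by at most cp, which vanishes after division by √n. This concentration
(`integral_exp_supForm_le_exp`) comes from the same interpolation, run between two independent
copies of a process and one copy used twice. For identical sets the maxima separate over j, and the
bounds become the general ones with c replaced by √p c. -/

/-- The standard Gaussian law on `ι → ℝ`. -/
noncomputable abbrev stdGauss (ι : Type*) [Fintype ι] : Measure (ι → ℝ) :=
  Measure.pi fun _ => gaussianReal 0 1

/-! ### Gaussian integrability and Stein's identity. -/

section Basic

variable {ι ι' : Type*} [Fintype ι] [Fintype ι']

theorem integrable_exp_mul_abs_gaussianReal (C : ℝ) :
    Integrable (fun x : ℝ => Real.exp (C * |x|)) (gaussianReal 0 1) :=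
  integrable_exp_mul_abs (X := fun x : ℝ => x) (integrable_exp_mul_gaussianReal C)
    (integrable_exp_mul_gaussianReal (-C))

/-- The universal dominating function: every integrand below grows at most exponentially in the ℓ¹
norm, and this bound factorises over coordinates. -/
theorem integrable_exp_sum_abs (C : ℝ) :
    Integrable (fun w : ι → ℝ => Real.exp (C * ∑ i, |w i|)) (stdGauss ι) := by
  have h := Integrable.fintype_prod (μ := fun _ : ι => gaussianReal 0 1)
    (f := fun _ x => Real.exp (C * |x|)) fun _ => integrable_exp_mul_abs_gaussianReal C
  refine h.congr (ae_of_all _ fun w => ?_)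
  simp only [Finset.mul_sum, Real.exp_sum]

theorem integrable_of_abs_le_exp {f : (ι → ℝ) → ℝ} (hf : AEStronglyMeasurable f (stdGauss ι))
    (D C : ℝ) (h : ∀ w, |f w| ≤ D * Real.exp (C * ∑ i, |w i|)) : Integrable f (stdGauss ι) :=
  Integrable.mono' ((integrable_exp_sum_abs C).const_mul D) hf (ae_of_all _ h)

theorem integrable_gaussianReal_of_abs_le_exp {f : ℝ → ℝ}
    (hf : AEStronglyMeasurable f (gaussianReal 0 1))
    (D C : ℝ) (h : ∀ x, |f x| ≤ D * Real.exp (C * |x|)) : Integrable f (gaussianReal 0 1) :=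
  Integrable.mono' ((integrable_exp_mul_abs_gaussianReal C).const_mul D) hf (ae_of_all _ h)

/-- A linear factor is absorbed by raising the exponential rate by one. -/
theorem abs_mul_le_exp {x y D C s : ℝ} (hy : |y| ≤ D * Real.exp (C * s)) (hx : |x| ≤ s) :
    |x * y| ≤ D * Real.exp ((C + 1) * s) := by
  have h1 : |x| ≤ Real.exp s := hx.trans ((le_add_of_nonneg_right zero_le_one).trans
    (Real.add_one_le_exp s))
  rw [abs_mul]
  calc |x| * |y| ≤ Real.exp s * (D * Real.exp (C * s)) :=
        mul_le_mul h1 hy (abs_nonneg _) (Real.exp_pos _).le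
    _ = D * Real.exp ((C + 1) * s) := by
        rw [add_mul, one_mul, Real.exp_add]; ring

theorem hasDerivAt_gaussianPDFReal (x : ℝ) :
    HasDerivAt (gaussianPDFReal 0 1) (-x * gaussianPDFReal 0 1 x) x := by
  rw [gaussianPDFReal_def]
  have h : HasDerivAt (fun x : ℝ => -(x - 0) ^ 2 / (2 * ((1 : NNReal) : ℝ))) (-x) x := by
    have := ((((hasDerivAt_id x).sub_const 0).pow 2).neg).div_const (2 * ((1 : NNReal) : ℝ))
    refine this.congr_deriv ?_
    simp
    ring
  refine (h.exp.const_mul _).congr_deriv ?_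
  ring

theorem integrable_gaussianPDFReal_mul {f : ℝ → ℝ} (hf : Integrable f (gaussianReal 0 1)) :
    Integrable (fun x => gaussianPDFReal 0 1 x * f x) := by
  rw [gaussianReal_of_var_ne_zero _ one_ne_zero, integrable_withDensity_iff_integrable_smul'
    (measurable_gaussianPDF _ _) (ae_of_all _ fun _ => gaussianPDF_lt_top)] at hf
  simpa [toReal_gaussianPDF] using hf

/-- Stein's identity in dimension one. -/
theorem integral_mul_gaussianReal {f f' : ℝ → ℝ} (hf : ∀ x, HasDerivAt f (f' x) x)
    (hf' : Continuous f') (D C : ℝ) (h : ∀ x, |f x| ≤ D * Real.exp (C * |x|))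
    (h' : ∀ x, |f' x| ≤ D * Real.exp (C * |x|)) :
    ∫ x, x * f x ∂gaussianReal 0 1 = ∫ x, f' x ∂gaussianReal 0 1 := by
  have hc : Continuous f := continuous_iff_continuousAt.2 fun x => (hf x).continuousAt
  have i0 : Integrable f (gaussianReal 0 1) :=
    integrable_gaussianReal_of_abs_le_exp hc.aestronglyMeasurable D C h
  have i1 : Integrable f' (gaussianReal 0 1) :=
    integrable_gaussianReal_of_abs_le_exp hf'.aestronglyMeasurable D C h'
  have i2 : Integrable (fun x => x * f x) (gaussianReal 0 1) :=
    integrable_gaussianReal_of_abs_le_exp (continuous_id.mul hc).aestronglyMeasurable D (C + 1)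
      fun x => abs_mul_le_exp (h x) le_rfl
  have j2 : Integrable (fun x => (-x * gaussianPDFReal 0 1 x) * f x) :=
    (integrable_gaussianPDFReal_mul i2).neg.congr (ae_of_all _ fun x => by
      simp only [Pi.neg_apply]; ring)
  rw [integral_gaussianReal_eq_integral_smul one_ne_zero,
    integral_gaussianReal_eq_integral_smul one_ne_zero]
  simp only [smul_eq_mul]
  rw [integral_mul_deriv_eq_deriv_mul_of_integrable
    (u' := fun x => -x * gaussianPDFReal 0 1 x)
    (fun x _ => hasDerivAt_gaussianPDFReal x) (fun x _ => hf x)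
    (integrable_gaussianPDFReal_mul i1) j2 (integrable_gaussianPDFReal_mul i0), ← integral_neg]
  congr 1
  ext x
  ring

/-- Resampling one coordinate preserves the law. This gives Fubini in coordinate j without splitting
the product space. -/
theorem measurePreserving_update [DecidableEq ι] (j : ι) :
    MeasurePreserving (fun q : (ι → ℝ) × ℝ => Function.update q.1 j q.2)
      ((stdGauss ι).prod (gaussianReal 0 1)) (stdGauss ι) := by
  have hm : Measurable (fun q : (ι → ℝ) × ℝ => Function.update q.1 j q.2) := by
    refine measurable_pi_lambda _ fun i => ?_
    by_cases hi : i = j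
    · subst hi; simpa using measurable_snd
    · simp only [Function.update_of_ne hi]
      fun_prop
  refine ⟨hm, (Measure.pi_eq fun s hs => ?_).symm⟩
  rw [Measure.map_apply hm (MeasurableSet.univ_pi hs)]
  -- The old j-th coordinate is overwritten, so it is unconstrained in the preimage.
  have hpre : (fun q : (ι → ℝ) × ℝ => Function.update q.1 j q.2) ⁻¹' Set.univ.pi s
      = (Set.univ.pi (Function.update s j Set.univ)) ×ˢ s j := by
    ext q
    simp only [Set.mem_preimage, Set.mem_pi, Set.mem_univ, true_imp_iff, Set.mem_prod]
    constructor
    · intro h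
      refine ⟨fun i => ?_, by simpa using h j⟩
      by_cases hi : i = j
      · subst hi; simp
      · simpa [hi] using h i
    · rintro ⟨h1, h2⟩ i
      by_cases hi : i = j
      · subst hi; simpa using h2
      · simpa [hi] using h1 i
  rw [hpre, Measure.prod_prod, Measure.pi_pi, ← Finset.prod_erase_mul _ _ (Finset.mem_univ j)]
  rw [← Finset.prod_erase_mul _ (fun i => gaussianReal 0 1 (s i)) (Finset.mem_univ j)]
  simp only [Function.update_self, measure_univ, mul_one]
  congr 1
  refine Finset.prod_congr rfl fun i hi => ?_
  rw [Function.update_of_ne (Finset.ne_of_mem_erase hi)]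

/-- Stein's identity for a standard Gaussian vector. -/
theorem integral_mul_stdGauss [DecidableEq ι] (j : ι) {f f' : (ι → ℝ) → ℝ}
    (hf : ∀ w t, HasDerivAt (fun t => f (Function.update w j t)) (f' (Function.update w j t)) t)
    (hc : Continuous f) (hc' : Continuous f') (D C : ℝ) (hD : 0 ≤ D) (hC : 0 ≤ C)
    (h : ∀ w, |f w| ≤ D * Real.exp (C * ∑ i, |w i|))
    (h' : ∀ w, |f' w| ≤ D * Real.exp (C * ∑ i, |w i|)) :
    ∫ w, w j * f w ∂stdGauss ι = ∫ w, f' w ∂stdGauss ι := by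
  have i1 : Integrable f' (stdGauss ι) :=
    integrable_of_abs_le_exp hc'.aestronglyMeasurable D C h'
  have i2 : Integrable (fun w => w j * f w) (stdGauss ι) :=
    integrable_of_abs_le_exp ((continuous_apply j).mul hc).aestronglyMeasurable D (C + 1)
      fun w => abs_mul_le_exp (h w)
        (Finset.single_le_sum (f := fun i => |w i|) (fun i _ => abs_nonneg _) (Finset.mem_univ j))
  have mp := measurePreserving_update (ι := ι) j
  have e (F : (ι → ℝ) → ℝ) (hF : Integrable F (stdGauss ι)) : ∫ w, F w ∂stdGauss ι
      = ∫ w, ∫ t, F (Function.update w j t) ∂gaussianReal 0 1 ∂stdGauss ι := by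
    have hF' := (mp.integrable_comp hF.aestronglyMeasurable).2 hF
    have h1 := integral_map mp.measurable.aemeasurable (f := F)
      (by rw [mp.map_eq]; exact hF.aestronglyMeasurable)
    rw [mp.map_eq] at h1
    exact h1.trans (integral_prod _ hF')
  rw [e _ i1, e _ i2]
  congr 1
  ext w
  -- With the other coordinates frozen, the growth bound is a constant times a one-dimensional one.
  have hb (t : ℝ) : Real.exp (C * ∑ i, |Function.update w j t i|)
      ≤ Real.exp (C * ∑ i, |w i|) * Real.exp (C * |t|) := by
    rw [← Real.exp_add, ← mul_add]
    refine Real.exp_le_exp.2 (mul_le_mul_of_nonneg_left ?_ hC)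
    have : ∀ i, |Function.update w j t i| ≤ |w i| + if i = j then |t| else 0 := fun i => by
      by_cases hi : i = j
      · subst hi; simp
      · simp [hi]
    refine (Finset.sum_le_sum fun i _ => this i).trans ?_
    simp [Finset.sum_add_distrib]
  have key := integral_mul_gaussianReal (hf w)
    (hc'.comp (continuous_const.update j continuous_id))
    (D * Real.exp (C * ∑ i, |w i|)) C
    (fun t => (h _).trans (by rw [mul_assoc]; exact mul_le_mul_of_nonneg_left (hb t) hD))
    (fun t => (h' _).trans (by rw [mul_assoc]; exact mul_le_mul_of_nonneg_left (hb t) hD))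
  simpa using key

theorem measurePreserving_inl_stdGauss :
    MeasurePreserving (fun (w : ι ⊕ ι' → ℝ) i => w (Sum.inl i)) (stdGauss (ι ⊕ ι'))
      (stdGauss ι) :=
  measurePreserving_fst.comp
    (measurePreserving_sumPiEquivProdPi (X := fun _ => ℝ) fun _ : ι ⊕ ι' => gaussianReal 0 1)

theorem measurePreserving_inr_stdGauss :
    MeasurePreserving (fun (w : ι ⊕ ι' → ℝ) i => w (Sum.inr i)) (stdGauss (ι ⊕ ι'))
      (stdGauss ι') :=
  measurePreserving_snd.comp
    (measurePreserving_sumPiEquivProdPi (X := fun _ => ℝ) fun _ : ι ⊕ ι' => gaussianReal 0 1)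

theorem integral_mul_stdGauss_sum (f : (ι → ℝ) → ℝ) (g : (ι' → ℝ) → ℝ) :
    ∫ w : ι ⊕ ι' → ℝ, f (fun i => w (Sum.inl i)) * g (fun i => w (Sum.inr i)) ∂stdGauss (ι ⊕ ι')
      = (∫ w, f w ∂stdGauss ι) * ∫ w, g w ∂stdGauss ι' := by
  rw [← integral_prod_mul, ← (measurePreserving_sumPiEquivProdPi (X := fun _ => ℝ)
    fun _ : ι ⊕ ι' => gaussianReal 0 1).integral_comp']
  rfl

theorem measurePreserving_curry_stdGauss :
    MeasurePreserving (fun (w : ι × ι' → ℝ) i j => w (i, j)) (stdGauss (ι × ι'))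
      (Measure.pi fun _ : ι => stdGauss ι') := by
  have h := Measure.infinitePi_map_curry (fun (_ : ι) (_ : ι') => gaussianReal 0 1)
  simp only [Measure.infinitePi_eq_pi] at h
  exact ⟨by fun_prop, h⟩

end Basic

/-! ### Interpolation between two Gaussian vectors by rotation. -/

section Interpolation

variable {κ ι ι' : Type*} [Fintype ι] [Fintype ι']

/-- The vector of values at `w` of the linear forms with coefficient vectors `u k`. -/
def linForms (u : κ → ι → ℝ) (w : ι → ℝ) : κ → ℝ := fun k => ∑ j, w j * u k j

@[fun_prop]
theorem continuous_linForms (u : κ → ι → ℝ) : Continuous (linForms u) := by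
  unfold linForms; fun_prop

theorem norm_linForms_le [Fintype κ] (u : κ → ι → ℝ) {R : ℝ} (hR : 0 ≤ R) (hu : ∀ k j, |u k j| ≤ R)
    (w : ι → ℝ) : ‖linForms u w‖ ≤ R * ∑ j, |w j| := by
  refine (pi_norm_le_iff_of_nonneg (mul_nonneg hR (Finset.sum_nonneg fun _ _ => abs_nonneg _))).2
    fun k => ?_
  rw [Real.norm_eq_abs, Finset.mul_sum]
  refine (Finset.abs_sum_le_sum_abs _ _).trans (Finset.sum_le_sum fun j _ => ?_)
  rw [abs_mul, mul_comm]
  exact mul_le_mul_of_nonneg_right (hu k j) (abs_nonneg _)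

theorem linForms_update [DecidableEq ι] (u : κ → ι → ℝ) (w : ι → ℝ) (j : ι) (t : ℝ) :
    HasDerivAt (fun t => linForms u (Function.update w j t)) (fun k => u k j) t := by
  refine hasDerivAt_pi.2 fun k => ?_
  have h : ∀ i ∈ Finset.univ, HasDerivAt (fun t => Function.update w j t i * u k i)
      (if i = j then u k i else 0) t := fun i _ => by
    by_cases hi : i = j
    · subst hi
      simpa using (hasDerivAt_id t).mul_const (u k i)
    · simpa [hi] using hasDerivAt_const t (w i * u k i)
  simpa [linForms] using HasDerivAt.fun_sum h

/-- The coefficients of `cos θ • a g + sin θ • b h` in the Gaussian vector `(g, h)`. -/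
noncomputable def rotPath (a : κ → ι → ℝ) (b : κ → ι' → ℝ) (θ : ℝ) : κ → ι ⊕ ι' → ℝ :=
  fun k => Sum.elim (fun i => Real.cos θ * a k i) fun i => Real.sin θ * b k i

/-- The derivative of `rotPath` in the angle. -/
noncomputable def rotPathDeriv (a : κ → ι → ℝ) (b : κ → ι' → ℝ) (θ : ℝ) : κ → ι ⊕ ι' → ℝ :=
  fun k => Sum.elim (fun i => -Real.sin θ * a k i) fun i => Real.cos θ * b k i

/-- This covariance between the velocity and the position of the path is what integration by parts
produces; only the difference of the two covariances survives. -/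
theorem sum_rotPathDeriv_mul (a : κ → ι → ℝ) (b : κ → ι' → ℝ) (θ : ℝ) (k l : κ) :
    ∑ j, rotPathDeriv a b θ k j * rotPath a b θ l j
      = Real.sin θ * Real.cos θ * (∑ i, b k i * b l i - ∑ i, a k i * a l i) := by
  simp only [rotPath, rotPathDeriv, Fintype.sum_sum_type, Sum.elim_inl, Sum.elim_inr, mul_sub,
    Finset.mul_sum]
  rw [sub_eq_add_neg, ← Finset.sum_neg_distrib, add_comm]
  congr 1 <;> exact Finset.sum_congr rfl fun i _ => by ring

theorem hasDerivAt_linForms_rotPath (a : κ → ι → ℝ) (b : κ → ι' → ℝ) (w : ι ⊕ ι' → ℝ) (θ : ℝ) :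
    HasDerivAt (fun θ => linForms (rotPath a b θ) w) (linForms (rotPathDeriv a b θ) w) θ := by
  refine hasDerivAt_pi.2 fun k => ?_
  simp only [linForms]
  refine HasDerivAt.fun_sum fun j _ => HasDerivAt.const_mul _ ?_
  cases j with
  | inl i => exact (Real.hasDerivAt_cos θ).mul_const _
  | inr i => exact (Real.hasDerivAt_sin θ).mul_const _

variable [Fintype κ]

/-- A function with the given bounded first and second partial derivatives. -/
structure BoundedC2 (G : (κ → ℝ) → ℝ) (G1 : κ → (κ → ℝ) → ℝ) (G2 : κ → κ → (κ → ℝ) → ℝ)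
    (C : ℝ) : Prop where
  nonneg : 0 ≤ C
  deriv_one : ∀ z, HasFDerivAt G (∑ k, G1 k z • ContinuousLinearMap.proj (R := ℝ)
    (φ := fun _ : κ => ℝ) k) z
  deriv_two : ∀ k z, HasFDerivAt (G1 k) (∑ l, G2 k l z • ContinuousLinearMap.proj (R := ℝ)
    (φ := fun _ : κ => ℝ) l) z
  bound_one : ∀ k z, |G1 k z| ≤ C
  bound_two : ∀ k l z, |G2 k l z| ≤ C
  continuous_two : ∀ k l, Continuous (G2 k l)

namespace BoundedC2

variable {G : (κ → ℝ) → ℝ} {G1 : κ → (κ → ℝ) → ℝ} {G2 : κ → κ → (κ → ℝ) → ℝ} {C : ℝ}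

theorem cont (h : BoundedC2 G G1 G2 C) : Continuous G :=
  continuous_iff_continuousAt.2 fun z => (h.deriv_one z).continuousAt

theorem continuous_one (h : BoundedC2 G G1 G2 C) (k : κ) : Continuous (G1 k) :=
  continuous_iff_continuousAt.2 fun z => (h.deriv_two k z).continuousAt

/-- Bounded gradient gives linear growth, hence exp ∘ G has Gaussian moments. -/
theorem le_norm (h : BoundedC2 G G1 G2 C) (z : κ → ℝ) :
    G z ≤ G 0 + Fintype.card κ * C * ‖z‖ := by
  have hb : ∀ y ∈ (Set.univ : Set (κ → ℝ)), ‖∑ k, G1 k y • ContinuousLinearMap.proj (R := ℝ)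
      (φ := fun _ : κ => ℝ) k‖ ≤ Fintype.card κ * C := fun y _ => by
    refine (norm_sum_le _ _).trans ?_
    rw [← nsmul_eq_mul]
    refine Finset.sum_le_card_nsmul _ _ _ fun k _ => ?_
    rw [norm_smul, Real.norm_eq_abs, ← mul_one C]
    refine mul_le_mul (h.bound_one k y) ?_ (norm_nonneg _) h.nonneg
    exact ContinuousLinearMap.opNorm_le_bound _ zero_le_one fun x => by
      simpa using norm_le_pi_norm x k
  have := Convex.norm_image_sub_le_of_norm_hasFDerivWithin_le
    (fun y _ => (h.deriv_one y).hasFDerivWithinAt) hb convex_univ (Set.mem_univ 0)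
    (Set.mem_univ z)
  rw [sub_zero, Real.norm_eq_abs] at this
  linarith [le_abs_self (G z - G 0)]

theorem exp_linForms_le (h : BoundedC2 G G1 G2 C) (u : κ → ι → ℝ) {R : ℝ} (hR : 0 ≤ R)
    (hu : ∀ k j, |u k j| ≤ R) (w : ι → ℝ) :
    Real.exp (G (linForms u w))
      ≤ Real.exp (G 0) * Real.exp (Fintype.card κ * C * R * ∑ j, |w j|) := by
  rw [← Real.exp_add, Real.exp_le_exp]
  refine (h.le_norm _).trans ?_
  have := mul_le_mul_of_nonneg_left (norm_linForms_le u hR hu w)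
    (mul_nonneg (Nat.cast_nonneg (Fintype.card κ)) h.nonneg)
  linarith

theorem hasDerivAt_exp_comp (h : BoundedC2 G G1 G2 C) {z : ℝ → κ → ℝ} {z' : κ → ℝ} {t : ℝ}
    (hz : HasDerivAt z z' t) :
    HasDerivAt (fun t => Real.exp (G (z t))) (Real.exp (G (z t)) * ∑ k, G1 k (z t) * z' k) t := by
  refine ((h.deriv_one (z t)).comp_hasDerivAt t hz).exp.congr_deriv ?_
  simp [smul_eq_mul]

theorem hasDerivAt_one_comp (h : BoundedC2 G G1 G2 C) (k : κ) {z : ℝ → κ → ℝ} {z' : κ → ℝ} {t : ℝ}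
    (hz : HasDerivAt z z' t) :
    HasDerivAt (fun t => G1 k (z t)) (∑ l, G2 k l (z t) * z' l) t := by
  refine ((h.deriv_two k (z t)).comp_hasDerivAt t hz).congr_deriv ?_
  simp [smul_eq_mul]

theorem exists_bound (u : κ → ι → ℝ) : ∃ R, 0 ≤ R ∧ ∀ k j, |u k j| ≤ R :=
  ⟨∑ k, ∑ j, |u k j|, by positivity, fun k j =>
    (Finset.single_le_sum (f := fun j => |u k j|) (fun _ _ => abs_nonneg _)
      (Finset.mem_univ j)).trans
    (Finset.single_le_sum (f := fun k => ∑ j, |u k j|)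
      (fun _ _ => Finset.sum_nonneg fun _ _ => abs_nonneg _) (Finset.mem_univ k))⟩

/-- `exp (G z)` times a bounded continuous function of `z`, at a linear image of a Gaussian
vector. -/
theorem integrable_exp_mul (h : BoundedC2 G G1 G2 C) (u : κ → ι → ℝ) {H : (κ → ℝ) → ℝ}
    (hH : Continuous H) (B : ℝ) (hB : ∀ z, |H z| ≤ B) :
    Integrable (fun w => Real.exp (G (linForms u w)) * H (linForms u w)) (stdGauss ι) := by
  obtain ⟨R, hR, hu⟩ := exists_bound u
  have hG := h.cont
  refine integrable_of_abs_le_exp (by fun_prop) (Real.exp (G 0) * B)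
    (Fintype.card κ * C * R) fun w => ?_
  rw [abs_mul, abs_of_pos (Real.exp_pos _), mul_right_comm]
  exact mul_le_mul (h.exp_linForms_le u hR hu w) (hB _) (abs_nonneg _)
    (mul_nonneg (Real.exp_pos _).le (Real.exp_pos _).le)

/-- Gaussian integration by parts along the linear forms `u`. -/
theorem integral_by_parts (h : BoundedC2 G G1 G2 C) (u u' : κ → ι → ℝ) :
    ∫ w, Real.exp (G (linForms u w)) * ∑ k, G1 k (linForms u w) * linForms u' w k ∂stdGauss ι
      = ∫ w, Real.exp (G (linForms u w)) * ∑ k, ∑ l, (∑ j, u' k j * u l j)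
          * (G1 k (linForms u w) * G1 l (linForms u w) + G2 k l (linForms u w)) ∂stdGauss ι := by
  classical
  obtain ⟨R, hR, hu⟩ := exists_bound u
  have hG := h.cont
  have hG1 := h.continuous_one
  have hG2 := h.continuous_two
  set M := Fintype.card κ * C * R with hM
  have hM0 : 0 ≤ M := by have := h.nonneg; positivity
  set E := fun w : ι → ℝ => Real.exp (G (linForms u w)) with hE
  have hE0 : ∀ w, 0 < E w := fun w => Real.exp_pos _
  have hEc : Continuous E := by fun_prop
  have hEb : ∀ w, E w ≤ Real.exp (G 0) * Real.exp (M * ∑ j, |w j|) :=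
    fun w => h.exp_linForms_le u hR hu w
  let f := fun (k : κ) (w : ι → ℝ) => E w * G1 k (linForms u w)
  let f' := fun (k : κ) (j : ι) (w : ι → ℝ) => E w * ∑ l, u l j
    * (G1 k (linForms u w) * G1 l (linForms u w) + G2 k l (linForms u w))
  have hfc : ∀ k, Continuous (f k) := fun k => by fun_prop
  have hfc' : ∀ k j, Continuous (f' k j) := fun k j => by fun_prop
  -- One constant for both uses: C bounds `G1`, and the remaining term bounds the sum over l in
  -- `f'`.
  obtain ⟨B, hB⟩ : ∃ B, B = C + Fintype.card κ * (R * (C * C + C)) := ⟨_, rfl⟩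
  have hC := h.nonneg
  have hB0 : 0 ≤ B := by rw [hB]; positivity
  have hS : ∀ k j w, |∑ l, u l j
      * (G1 k (linForms u w) * G1 l (linForms u w) + G2 k l (linForms u w))| ≤ B := by
    intro k j w
    refine (Finset.abs_sum_le_sum_abs _ _).trans ?_
    refine (Finset.sum_le_card_nsmul _ _ (R * (C * C + C)) fun l _ => ?_).trans ?_
    · rw [abs_mul]
      refine mul_le_mul (hu l j) ((abs_add_le _ _).trans (add_le_add ?_ (h.bound_two _ _ _)))
        (abs_nonneg _) hR
      rw [abs_mul]
      exact mul_le_mul (h.bound_one _ _) (h.bound_one _ _) (abs_nonneg _) hC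
    · rw [nsmul_eq_mul, hB, Finset.card_univ]; linarith
  have hfb : ∀ k w, |f k w| ≤ Real.exp (G 0) * B * Real.exp (M * ∑ j, |w j|) := fun k w => by
    rw [abs_mul, abs_of_pos (hE0 w), mul_right_comm]
    refine mul_le_mul (hEb w) ((h.bound_one _ _).trans ?_) (abs_nonneg _) (by positivity)
    rw [hB]; exact le_add_of_nonneg_right (by positivity)
  have hfb' : ∀ k j w, |f' k j w| ≤ Real.exp (G 0) * B * Real.exp (M * ∑ j, |w j|) :=
    fun k j w => by
      rw [abs_mul, abs_of_pos (hE0 w), mul_right_comm]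
      exact mul_le_mul (hEb w) (hS k j w) (abs_nonneg _) (by positivity)
  have hint : ∀ k j, Integrable (fun w => w j * f k w) (stdGauss ι) := fun k j =>
    integrable_of_abs_le_exp ((continuous_apply j).mul (hfc k)).aestronglyMeasurable _ _
      fun w => abs_mul_le_exp (hfb k w)
        (Finset.single_le_sum (f := fun i => |w i|) (fun i _ => abs_nonneg _) (Finset.mem_univ j))
  have hint' : ∀ k j, Integrable (f' k j) (stdGauss ι) := fun k j =>
    integrable_of_abs_le_exp (hfc' k j).aestronglyMeasurable _ _ (hfb' k j)
  have stein : ∀ k j, ∫ w, w j * f k w ∂stdGauss ι = ∫ w, f' k j w ∂stdGauss ι := fun k j => by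
    refine integral_mul_stdGauss j (fun w t => ?_) (hfc k) (hfc' k j) _ M
      (mul_nonneg (Real.exp_pos _).le hB0) hM0 (hfb k) (hfb' k j)
    have hz := linForms_update u w j t
    refine ((h.hasDerivAt_exp_comp hz).mul (h.hasDerivAt_one_comp k hz)).congr_deriv ?_
    simp only [f', E, Finset.mul_sum, Finset.sum_mul, ← Finset.sum_add_distrib]
    refine Finset.sum_congr rfl fun l _ => ?_
    ring
  calc _ = ∫ w, ∑ k, ∑ j, u' k j * (w j * f k w) ∂stdGauss ι := by
        congr 1; ext w
        simp only [f, linForms, Finset.mul_sum]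
        refine Finset.sum_congr rfl fun k _ => Finset.sum_congr rfl fun j _ => ?_
        simp only [E]
        ring
    _ = ∑ k, ∑ j, u' k j * ∫ w, f' k j w ∂stdGauss ι := by
        rw [integral_finsetSum _ fun k _ => integrable_finsetSum _ fun j _ =>
          (hint k j).const_mul _]
        refine Finset.sum_congr rfl fun k _ => ?_
        rw [integral_finsetSum _ fun j _ => (hint k j).const_mul _]
        refine Finset.sum_congr rfl fun j _ => ?_
        rw [integral_const_mul, stein]
    _ = ∫ w, ∑ k, ∑ j, u' k j * f' k j w ∂stdGauss ι := by
        rw [integral_finsetSum _ fun k _ => integrable_finsetSum _ fun j _ =>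
          (hint' k j).const_mul _]
        refine Finset.sum_congr rfl fun k _ => ?_
        rw [integral_finsetSum _ fun j _ => (hint' k j).const_mul _]
        simp only [integral_const_mul]
    _ = _ := by
        congr 1; ext w
        simp only [f', Finset.mul_sum]
        refine Finset.sum_congr rfl fun k _ => ?_
        rw [Finset.sum_comm]
        refine Finset.sum_congr rfl fun l _ => ?_
        rw [Finset.sum_mul, Finset.mul_sum]
        refine Finset.sum_congr rfl fun j _ => ?_
        simp only [E]
        ring

end BoundedC2

namespace BoundedC2

variable {G : (κ → ℝ) → ℝ} {G1 : κ → (κ → ℝ) → ℝ} {G2 : κ → κ → (κ → ℝ) → ℝ} {C : ℝ}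

theorem hasDerivAt_integral_rotPath (h : BoundedC2 G G1 G2 C) (a : κ → ι → ℝ) (b : κ → ι' → ℝ)
    (θ : ℝ) :
    HasDerivAt (fun θ => ∫ w, Real.exp (G (linForms (rotPath a b θ) w)) ∂stdGauss (ι ⊕ ι'))
      (∫ w, Real.exp (G (linForms (rotPath a b θ) w))
        * ∑ k, G1 k (linForms (rotPath a b θ) w) * linForms (rotPathDeriv a b θ) w k
        ∂stdGauss (ι ⊕ ι')) θ := by
  have hG := h.cont
  have hG1 := h.continuous_one
  have hC := h.nonneg
  obtain ⟨Ra, hRa, ha⟩ := exists_bound a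
  obtain ⟨Rb, hRb, hb⟩ := exists_bound b
  have hb1 : ∀ θ k j, |rotPath a b θ k j| ≤ Ra + Rb := fun θ k j => by
    cases j with
    | inl i =>
      simp only [rotPath, Sum.elim_inl, abs_mul]
      have := mul_le_mul (Real.abs_cos_le_one θ) (ha k i) (abs_nonneg _) zero_le_one
      linarith
    | inr i =>
      simp only [rotPath, Sum.elim_inr, abs_mul]
      have := mul_le_mul (Real.abs_sin_le_one θ) (hb k i) (abs_nonneg _) zero_le_one
      linarith
  have hb2 : ∀ θ k j, |rotPathDeriv a b θ k j| ≤ Ra + Rb := fun θ k j => by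
    cases j with
    | inl i =>
      simp only [rotPathDeriv, Sum.elim_inl, abs_mul, abs_neg]
      have := mul_le_mul (Real.abs_sin_le_one θ) (ha k i) (abs_nonneg _) zero_le_one
      linarith
    | inr i =>
      simp only [rotPathDeriv, Sum.elim_inr, abs_mul]
      have := mul_le_mul (Real.abs_cos_le_one θ) (hb k i) (abs_nonneg _) zero_le_one
      linarith
  set R := Ra + Rb with hRdef
  have hR : 0 ≤ R := add_nonneg hRa hRb
  set M := Fintype.card κ * C * R with hM
  -- The rate `M + 1` absorbs the linear factor coming from the velocity of the path; the bound is
  -- uniform in the angle.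
  set bd := fun w : ι ⊕ ι' → ℝ => Fintype.card κ * (C * R) * (Real.exp (G 0)
    * Real.exp ((M + 1) * ∑ j, |w j|)) with hbd
  refine (hasDerivAt_integral_of_dominated_loc_of_deriv_le (bound := bd)
    (F := fun θ w => Real.exp (G (linForms (rotPath a b θ) w)))
    (F' := fun θ w => Real.exp (G (linForms (rotPath a b θ) w))
        * ∑ k, G1 k (linForms (rotPath a b θ) w) * linForms (rotPathDeriv a b θ) w k)
    univ_mem (Eventually.of_forall fun θ => ?_) ?_ ?_ (ae_of_all _ fun w θ _ => ?_)
    ?_ (ae_of_all _ fun w θ _ => ?_)).2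
  · exact Continuous.aestronglyMeasurable (by fun_prop)
  · simpa using h.integrable_exp_mul (rotPath a b θ) (H := fun _ => 1) continuous_const 1 (by simp)
  · refine Continuous.aestronglyMeasurable ?_
    have : ∀ k, Continuous fun w => linForms (rotPathDeriv a b θ) w k := fun k =>
      (continuous_apply k).comp (continuous_linForms _)
    fun_prop
  · set s := ∑ j, |w j| with hs
    have hs0 : 0 ≤ s := Finset.sum_nonneg fun _ _ => abs_nonneg _
    have h1 : |∑ k, G1 k (linForms (rotPath a b θ) w) * linForms (rotPathDeriv a b θ) w k|
        ≤ Fintype.card κ * (C * R) * s := by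
      refine (Finset.abs_sum_le_sum_abs _ _).trans
        ((Finset.sum_le_card_nsmul _ _ (C * (R * s)) fun k _ => ?_).trans ?_)
      · rw [abs_mul]
        refine mul_le_mul (h.bound_one _ _) ?_ (abs_nonneg _) hC
        exact (norm_le_pi_norm (linForms (rotPathDeriv a b θ) w) k).trans
          (norm_linForms_le _ hR (hb2 θ) w)
      · rw [nsmul_eq_mul, Finset.card_univ]; exact le_of_eq (by ring)
    have h2 := h.exp_linForms_le (rotPath a b θ) hR (hb1 θ) w
    rw [Real.norm_eq_abs, abs_mul, abs_of_pos (Real.exp_pos _)]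
    have h3 : s ≤ Real.exp s := (le_add_of_nonneg_right zero_le_one).trans (Real.add_one_le_exp s)
    calc _ ≤ (Real.exp (G 0) * Real.exp (M * s)) * (Fintype.card κ * (C * R) * Real.exp s) :=
          mul_le_mul h2 (h1.trans (mul_le_mul_of_nonneg_left h3 (by positivity)))
            (abs_nonneg _) (by positivity)
      _ = bd w := by
          simp only [hbd, ← hs, add_mul, one_mul, Real.exp_add]; ring
  · exact ((integrable_exp_sum_abs _).const_mul _).const_mul _
  · exact h.hasDerivAt_exp_comp (hasDerivAt_linForms_rotPath a b w θ)

/-- Comparison of two Gaussian vectors along the rotation path. -/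
theorem integral_exp_le (h : BoundedC2 G G1 G2 C) (a : κ → ι → ℝ) (b : κ → ι' → ℝ) (v : ℝ)
    (hv : ∀ z, v ≤ ∑ k, ∑ l, (∑ i, b k i * b l i - ∑ i, a k i * a l i)
      * (G1 k z * G1 l z + G2 k l z)) :
    Real.exp (v / 2) * ∫ w, Real.exp (G (linForms a w)) ∂stdGauss ι
      ≤ ∫ w, Real.exp (G (linForms b w)) ∂stdGauss ι' := by
  have hG := h.cont
  have hG1 := h.continuous_one
  have hG2 := h.continuous_two
  have hC := h.nonneg
  set φ := fun θ => ∫ w, Real.exp (G (linForms (rotPath a b θ) w)) ∂stdGauss (ι ⊕ ι') with hφ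
  set Δ := fun k l => ∑ i, b k i * b l i - ∑ i, a k i * a l i with hΔ
  set Q := fun z => ∑ k, ∑ l, Δ k l * (G1 k z * G1 l z + G2 k l z) with hQ
  set φ' := fun θ => Real.sin θ * Real.cos θ
    * ∫ w, Real.exp (G (linForms (rotPath a b θ) w)) * Q (linForms (rotPath a b θ) w)
      ∂stdGauss (ι ⊕ ι') with hφ'
  have hQc : Continuous Q := by fun_prop
  have hQb : ∀ z, |Q z| ≤ ∑ k, ∑ l, |Δ k l| * (C * C + C) := fun z => by
    refine (Finset.abs_sum_le_sum_abs _ _).trans (Finset.sum_le_sum fun k _ =>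
      (Finset.abs_sum_le_sum_abs _ _).trans (Finset.sum_le_sum fun l _ => ?_))
    rw [abs_mul]
    refine mul_le_mul_of_nonneg_left ((abs_add_le _ _).trans
      (add_le_add ?_ (h.bound_two _ _ _))) (abs_nonneg _)
    rw [abs_mul]
    exact mul_le_mul (h.bound_one _ _) (h.bound_one _ _) (abs_nonneg _) hC
  have hd : ∀ θ, HasDerivAt φ (φ' θ) θ := fun θ => by
    refine (h.hasDerivAt_integral_rotPath a b θ).congr_deriv ?_
    rw [h.integral_by_parts]
    simp only [hφ']
    rw [← integral_const_mul]
    congr 1; ext w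
    simp only [sum_rotPathDeriv_mul, hQ, Finset.mul_sum, hΔ]
    refine Finset.sum_congr rfl fun k _ => Finset.sum_congr rfl fun l _ => ?_
    ring
  have hle : ∀ θ ∈ Set.Icc 0 (Real.pi / 2), v * (Real.sin θ * Real.cos θ) * φ θ ≤ φ' θ := by
    intro θ hθ
    have h0 : 0 ≤ Real.sin θ * Real.cos θ := mul_nonneg
      (Real.sin_nonneg_of_nonneg_of_le_pi hθ.1 (by linarith [hθ.2, Real.pi_pos]))
      (Real.cos_nonneg_of_neg_pi_div_two_le_of_le (by linarith [hθ.1, Real.pi_pos]) hθ.2)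
    rw [mul_comm v, mul_assoc]
    refine mul_le_mul_of_nonneg_left ?_ h0
    rw [hφ, ← integral_const_mul]
    refine integral_mono ?_ (h.integrable_exp_mul _ hQc _ hQb) fun w => ?_
    · simpa using (h.integrable_exp_mul (rotPath a b θ) (H := fun _ => 1) continuous_const 1
        (by simp)).const_mul v
    · simp only
      rw [mul_comm]
      exact mul_le_mul_of_nonneg_left (hv _) (Real.exp_pos _).le
  -- Integrating factor for φ' ≥ v sin θ cos θ φ, since (v/2) sin² θ has derivative v sin θ cos θ;
  -- its value v/2 at π/2 is the exponent in the conclusion.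
  set ψ := fun θ => Real.exp (-(v / 2 * Real.sin θ ^ 2)) * φ θ with hψ
  have hdψ : ∀ θ, HasDerivAt ψ (Real.exp (-(v / 2 * Real.sin θ ^ 2))
      * (φ' θ - v * (Real.sin θ * Real.cos θ) * φ θ)) θ := fun θ => by
    have h1 := (((Real.hasDerivAt_sin θ).pow 2).const_mul (v / 2)).neg.exp
    refine (h1.mul (hd θ)).congr_deriv ?_
    simp
    ring
  have hmono : MonotoneOn ψ (Set.Icc 0 (Real.pi / 2)) := by
    refine monotoneOn_of_hasDerivWithinAt_nonneg (convex_Icc _ _)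
      (fun θ _ => (hdψ θ).continuousAt.continuousWithinAt)
      (fun θ _ => (hdψ θ).hasDerivWithinAt) fun θ hθ => ?_
    exact mul_nonneg (Real.exp_pos _).le (sub_nonneg.2 (hle θ (interior_subset hθ)))
  have hfin := hmono (Set.left_mem_Icc.2 (by positivity)) (Set.right_mem_Icc.2 (by positivity))
    (by positivity)
  have e0 : φ 0 = ∫ w, Real.exp (G (linForms a w)) ∂stdGauss ι := by
    rw [← (measurePreserving_inl_stdGauss (ι := ι) (ι' := ι')).map_eq, integral_map
      measurePreserving_inl_stdGauss.measurable.aemeasurable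
      (Continuous.aestronglyMeasurable (by fun_prop))]
    simp only [hφ]
    congr 1; ext w; congr 2; ext k
    simp [linForms, rotPath]
  have e1 : φ (Real.pi / 2) = ∫ w, Real.exp (G (linForms b w)) ∂stdGauss ι' := by
    rw [← (measurePreserving_inr_stdGauss (ι := ι) (ι' := ι')).map_eq, integral_map
      measurePreserving_inr_stdGauss.measurable.aemeasurable
      (Continuous.aestronglyMeasurable (by fun_prop))]
    simp only [hφ]
    congr 1; ext w; congr 2; ext k
    simp [linForms, rotPath]
  simp only [hψ, Real.sin_zero, Real.sin_pi_div_two] at hfin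
  rw [e0, e1] at hfin
  simp only [ne_eq, OfNat.ofNat_ne_zero, not_false_eq_true, zero_pow, mul_zero, neg_zero,
    Real.exp_zero, one_mul, one_pow, mul_one] at hfin
  calc _ ≤ Real.exp (v / 2) * (Real.exp (-(v / 2))
        * ∫ w, Real.exp (G (linForms b w)) ∂stdGauss ι') :=
        mul_le_mul_of_nonneg_left hfin (Real.exp_pos _).le
    _ = _ := by rw [← mul_assoc, ← Real.exp_add, add_neg_cancel, Real.exp_zero, one_mul]

end BoundedC2

end Interpolation

/-! ### Log-partition functions as smooth maxima. -/

section LogSumExp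

variable {κ : Type*} [Fintype κ]

/-- Needed for concentration, where the exponent is a difference of two log-partition functions. -/
theorem BoundedC2.add {G G' : (κ → ℝ) → ℝ} {G1 G1' : κ → (κ → ℝ) → ℝ}
    {G2 G2' : κ → κ → (κ → ℝ) → ℝ} {C C' : ℝ} (h : BoundedC2 G G1 G2 C)
    (h' : BoundedC2 G' G1' G2' C') :
    BoundedC2 (fun z => G z + G' z) (fun k z => G1 k z + G1' k z)
      (fun k l z => G2 k l z + G2' k l z) (C + C') where
  nonneg := add_nonneg h.nonneg h'.nonneg
  deriv_one z := by
    refine ((h.deriv_one z).add (h'.deriv_one z)).congr_fderiv ?_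
    simp only [add_smul, Finset.sum_add_distrib]
  deriv_two k z := by
    refine ((h.deriv_two k z).add (h'.deriv_two k z)).congr_fderiv ?_
    simp only [add_smul, Finset.sum_add_distrib]
  bound_one k z := (abs_add_le _ _).trans (add_le_add (h.bound_one k z) (h'.bound_one k z))
  bound_two k l z := (abs_add_le _ _).trans (add_le_add (h.bound_two k l z) (h'.bound_two k l z))
  continuous_two k l := (h.continuous_two k l).add (h'.continuous_two k l)

/-- The partition function `∑ₖ mₖ exp (β zₖ)`. -/
noncomputable def partitionFn (m : κ → ℝ) (β : ℝ) (z : κ → ℝ) : ℝ :=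
  ∑ k, m k * Real.exp (β * z k)

/-- The Gibbs weights of `partitionFn`. -/
noncomputable def gibbsWeight (m : κ → ℝ) (β : ℝ) (k : κ) (z : κ → ℝ) : ℝ :=
  m k * Real.exp (β * z k) / partitionFn m β z

variable {m : κ → ℝ}

theorem partitionFn_pos (hm : ∀ k, 0 ≤ m k) (hm' : ∃ k, 0 < m k) (β : ℝ) (z : κ → ℝ) :
    0 < partitionFn m β z := by
  obtain ⟨k, hk⟩ := hm'
  exact Finset.sum_pos' (fun k _ => mul_nonneg (hm k) (Real.exp_pos _).le)
    ⟨k, Finset.mem_univ k, mul_pos hk (Real.exp_pos _)⟩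

theorem gibbsWeight_nonneg (hm : ∀ k, 0 ≤ m k) (hm' : ∃ k, 0 < m k) (β : ℝ) (k : κ) (z : κ → ℝ) :
    0 ≤ gibbsWeight m β k z :=
  div_nonneg (mul_nonneg (hm k) (Real.exp_pos _).le) (partitionFn_pos hm hm' β z).le

theorem sum_gibbsWeight (hm : ∀ k, 0 ≤ m k) (hm' : ∃ k, 0 < m k) (β : ℝ) (z : κ → ℝ) :
    ∑ k, gibbsWeight m β k z = 1 := by
  simp only [gibbsWeight, ← Finset.sum_div]
  exact div_self (partitionFn_pos hm hm' β z).ne'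

theorem gibbsWeight_le_one (hm : ∀ k, 0 ≤ m k) (hm' : ∃ k, 0 < m k) (β : ℝ) (k : κ)
    (z : κ → ℝ) : gibbsWeight m β k z ≤ 1 := by
  rw [← sum_gibbsWeight hm hm' β z]
  exact Finset.single_le_sum (f := fun k => gibbsWeight m β k z)
    (fun k _ => gibbsWeight_nonneg hm hm' β k z) (Finset.mem_univ k)

theorem hasFDerivAt_mul_exp (x β : ℝ) (k : κ) (z : κ → ℝ) :
    HasFDerivAt (fun z : κ → ℝ => x * Real.exp (β * z k))
      ((β * (x * Real.exp (β * z k))) • ContinuousLinearMap.proj (R := ℝ)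
        (φ := fun _ : κ => ℝ) k) z := by
  have h := (((hasFDerivAt_apply (𝕜 := ℝ) (F' := fun _ : κ => ℝ) k z).const_mul β).exp).const_mul x
  refine h.congr_fderiv ?_
  ext y
  simp
  ring

theorem hasFDerivAt_partitionFn (β : ℝ) (z : κ → ℝ) :
    HasFDerivAt (partitionFn m β) (∑ k, (β * (m k * Real.exp (β * z k))) •
      ContinuousLinearMap.proj (R := ℝ) (φ := fun _ : κ => ℝ) k) z :=
  HasFDerivAt.fun_sum fun k _ => hasFDerivAt_mul_exp (m k) β k z

/-- The gradient is given by the Gibbs weights and the Hessian by their covariance matrix. General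
weights m allow 0/1 choices that select one of two copies of a process. -/
theorem boundedC2_log_partitionFn [DecidableEq κ] (hm : ∀ k, 0 ≤ m k) (hm' : ∃ k, 0 < m k)
    (s β : ℝ) :
    BoundedC2 (fun z => s * Real.log (partitionFn m β z))
      (fun k z => s * β * gibbsWeight m β k z)
      (fun k l z => s * β ^ 2 * ((if k = l then gibbsWeight m β k z else 0)
        - gibbsWeight m β k z * gibbsWeight m β l z)) (|s * β| + |s * β ^ 2|) where
  nonneg := by positivity
  deriv_one z := by
    have hZ := (partitionFn_pos hm hm' β z).ne'
    refine (((hasFDerivAt_partitionFn β z).log hZ).const_mul s).congr_fderiv ?_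
    simp only [Finset.smul_sum, smul_smul]
    refine Finset.sum_congr rfl fun k _ => ?_
    congr 1
    simp only [gibbsWeight]
    field_simp
  deriv_two k z := by
    have hZ := (partitionFn_pos hm hm' β z).ne'
    have h1 := (hasDerivAt_inv hZ).comp_hasFDerivAt z (hasFDerivAt_partitionFn (m := m) β z)
    have h := (((hasFDerivAt_mul_exp (m k) β k z).mul h1).const_mul (s * β))
    refine h.congr_fderiv ?_
    ext y
    simp only [_root_.add_apply, _root_.smul_apply,
      _root_.sum_apply, ContinuousLinearMap.proj_apply, smul_eq_mul, gibbsWeight,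
      mul_sub, sub_mul, mul_ite, ite_mul, mul_zero, zero_mul, Finset.sum_sub_distrib,
      Finset.sum_ite_eq, Finset.mem_univ, if_true, Function.comp_apply]
    rw [mul_add, add_comm, sub_eq_add_neg]
    congr 1
    · field_simp
    · rw [← Finset.sum_neg_distrib, Finset.mul_sum, Finset.mul_sum, Finset.mul_sum]
      refine Finset.sum_congr rfl fun l _ => ?_
      field_simp
  bound_one k z := by
    rw [abs_mul, abs_of_nonneg (gibbsWeight_nonneg hm hm' β k z)]
    have := mul_le_mul_of_nonneg_left (gibbsWeight_le_one hm hm' β k z) (abs_nonneg (s * β))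
    linarith [abs_nonneg (s * β ^ 2)]
  bound_two k l z := by
    have hk := gibbsWeight_nonneg hm hm' β k z
    have hl := gibbsWeight_nonneg hm hm' β l z
    have hk' := gibbsWeight_le_one hm hm' β k z
    have hl' := gibbsWeight_le_one hm hm' β l z
    have h1 : |(if k = l then gibbsWeight m β k z else 0)
        - gibbsWeight m β k z * gibbsWeight m β l z| ≤ 1 := by
      rw [abs_le]
      split_ifs <;> constructor <;> nlinarith
    rw [abs_mul]
    have := mul_le_mul_of_nonneg_left h1 (abs_nonneg (s * β ^ 2))
    linarith [abs_nonneg (s * β)]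
  continuous_two k l := by
    have hZc : Continuous (partitionFn m β) := by unfold partitionFn; fun_prop
    have hc : ∀ k, Continuous (gibbsWeight m β k) := fun k =>
      Continuous.div (by fun_prop) hZc fun z => (partitionFn_pos hm hm' β z).ne'
    have h2 : Continuous fun z => if k = l then gibbsWeight m β k z else 0 := by
      split_ifs
      exacts [hc k, continuous_const]
    exact continuous_const.mul (h2.sub ((hc k).mul (hc l)))

theorem le_log_partitionFn (hm : ∀ k, 0 ≤ m k) {β : ℝ} {k : κ} (hk : 1 ≤ m k) (z : κ → ℝ) :
    β * z k ≤ Real.log (partitionFn m β z) := by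
  rw [Real.le_log_iff_exp_le (partitionFn_pos hm ⟨k, one_pos.trans_le hk⟩ β z)]
  refine (le_mul_of_one_le_left (Real.exp_pos _).le hk).trans ?_
  exact Finset.single_le_sum (f := fun k => m k * Real.exp (β * z k))
    (fun k _ => mul_nonneg (hm k) (Real.exp_pos _).le) (Finset.mem_univ k)

theorem log_partitionFn_le (hm : ∀ k, 0 ≤ m k) (hm' : ∃ k, 0 < m k) {β M : ℝ} (hβ : 0 ≤ β)
    {z : κ → ℝ} (hz : ∀ k, 0 < m k → z k ≤ M) :
    Real.log (partitionFn m β z) ≤ Real.log (∑ k, m k) + β * M := by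
  have hs : 0 < ∑ k, m k := by
    obtain ⟨k, hk⟩ := hm'
    exact Finset.sum_pos' (fun k _ => hm k) ⟨k, Finset.mem_univ k, hk⟩
  rw [Real.log_le_iff_le_exp (partitionFn_pos hm hm' β z), Real.exp_add, Real.exp_log hs,
    Finset.sum_mul]
  refine Finset.sum_le_sum fun k _ => ?_
  rcases (hm k).eq_or_lt with h | h
  · rw [← h]; simp
  · exact mul_le_mul_of_nonneg_left (Real.exp_le_exp.2
      (mul_le_mul_of_nonneg_left (hz k h) hβ)) (hm k)

end LogSumExp

/-! ### Suprema of Gaussian linear forms over an arbitrary index set. -/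

section SupForm

variable {I ι ι' : Type*} [Fintype ι] [Fintype ι']

/-- The supremum of the linear forms with coefficient vectors `a i`. -/
noncomputable def supForm (a : I → ι → ℝ) (w : ι → ℝ) : ℝ := ⨆ i, linForms a w i

variable {a : I → ι → ℝ} {R : ℝ}

theorem abs_linForms_le (ha : ∀ i j, |a i j| ≤ R) (w : ι → ℝ) (i : I) :
    |linForms a w i| ≤ R * ∑ j, |w j| := by
  rw [Finset.mul_sum]
  refine (Finset.abs_sum_le_sum_abs _ _).trans (Finset.sum_le_sum fun j _ => ?_)
  rw [abs_mul, mul_comm]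
  exact mul_le_mul_of_nonneg_right (ha i j) (abs_nonneg _)

theorem bddAbove_linForms (ha : ∀ i j, |a i j| ≤ R) (w : ι → ℝ) :
    BddAbove (Set.range (linForms a w)) :=
  ⟨R * ∑ j, |w j|, by rintro _ ⟨i, rfl⟩; exact (abs_le.1 (abs_linForms_le ha w i)).2⟩

theorem linForms_le_supForm (ha : ∀ i j, |a i j| ≤ R) (w : ι → ℝ) (i : I) :
    linForms a w i ≤ supForm a w := le_ciSup (bddAbove_linForms ha w) i

variable [Nonempty I]

theorem abs_supForm_le (ha : ∀ i j, |a i j| ≤ R) (w : ι → ℝ) :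
    |supForm a w| ≤ R * ∑ j, |w j| := by
  obtain ⟨i⟩ := ‹Nonempty I›
  refine abs_le.2 ⟨?_, @ciSup_le _ _ _ ⟨i⟩ _ _ fun i => (abs_le.1 (abs_linForms_le ha w i)).2⟩
  exact (abs_le.1 (abs_linForms_le ha w i)).1.trans (linForms_le_supForm ha w i)

/-- A supremum of uniformly Lipschitz forms is Lipschitz. Continuity, hence measurability, follows
even for uncountable index sets. -/
theorem supForm_sub_le (ha : ∀ i j, |a i j| ≤ R) (w w' : ι → ℝ) :
    supForm a w - supForm a w' ≤ R * ∑ j, |w j - w' j| := by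
  rw [sub_le_iff_le_add]
  refine ciSup_le fun i => ?_
  have h1 := (abs_le.1 (abs_linForms_le ha (w - w') i)).2
  have h2 := linForms_le_supForm ha w' i
  have h3 : linForms a (w - w') i = linForms a w i - linForms a w' i := by
    simp [linForms, sub_mul]
  simp only [Pi.sub_apply] at h1
  linarith

theorem continuous_supForm (ha : ∀ i j, |a i j| ≤ R) : Continuous (supForm a) := by
  refine continuous_iff_continuousAt.2 fun w => ?_
  refine tendsto_iff_norm_sub_tendsto_zero.2 ?_
  refine squeeze_zero (fun _ => norm_nonneg _)
    (g := fun w' => R * ∑ j, |w' j - w j|) (fun w' => ?_) ?_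
  · rw [Real.norm_eq_abs]
    refine abs_sub_le_iff.2 ⟨supForm_sub_le ha w' w, ?_⟩
    simp only [abs_sub_comm (w' _)]
    exact supForm_sub_le ha w w'
  · have : Continuous fun w' : ι → ℝ => R * ∑ j, |w' j - w j| := by fun_prop
    simpa using this.tendsto w

theorem integrable_supForm (ha : ∀ i j, |a i j| ≤ R) :
    Integrable (supForm a) (stdGauss ι) := by
  refine integrable_of_abs_le_exp (continuous_supForm ha).aestronglyMeasurable |R| 1 fun w => ?_
  have hs : 0 ≤ ∑ j, |w j| := Finset.sum_nonneg fun _ _ => abs_nonneg _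
  refine (abs_supForm_le ha w).trans ((mul_le_mul_of_nonneg_right (le_abs_self R) hs).trans
    (mul_le_mul_of_nonneg_left ?_ (abs_nonneg R)))
  rw [one_mul]
  linarith [Real.add_one_le_exp (∑ j, |w j|)]

theorem exp_mul_supForm_le (ha : ∀ i j, |a i j| ≤ R) (c : ℝ) (w : ι → ℝ) :
    Real.exp (c * supForm a w) ≤ Real.exp (|c| * R * ∑ j, |w j|) := by
  refine Real.exp_le_exp.2 ((le_abs_self _).trans ?_)
  rw [abs_mul, mul_assoc]
  exact mul_le_mul_of_nonneg_left (abs_supForm_le ha w) (abs_nonneg _)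

theorem integrable_exp_mul_supForm (ha : ∀ i j, |a i j| ≤ R) (c : ℝ) :
    Integrable (fun w => Real.exp (c * supForm a w)) (stdGauss ι) := by
  refine integrable_of_abs_le_exp (Real.continuous_exp.comp (continuous_const.mul
    (continuous_supForm ha))).aestronglyMeasurable 1 (|c| * R) fun w => ?_
  rw [abs_of_pos (Real.exp_pos _), one_mul]
  exact exp_mul_supForm_le ha c w

/-- Jensen for the exponential, by integrating its tangent line at the mean. -/
theorem exp_integral_le_integral_exp {Ω : Type*} [MeasurableSpace Ω] {μ : Measure Ω}
    [IsProbabilityMeasure μ] {X : Ω → ℝ} (hX : Integrable X μ)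
    (hX' : Integrable (fun ω => Real.exp (X ω)) μ) :
    Real.exp (∫ ω, X ω ∂μ) ≤ ∫ ω, Real.exp (X ω) ∂μ := by
  set e := ∫ ω, X ω ∂μ with he
  have h : ∫ ω, Real.exp e * (X ω - e + 1) ∂μ ≤ ∫ ω, Real.exp (X ω) ∂μ := by
    refine integral_mono (((hX.sub (integrable_const _)).add (integrable_const _)).const_mul _)
      hX' fun ω => ?_
    calc Real.exp e * (X ω - e + 1) ≤ Real.exp e * Real.exp (X ω - e) :=
          mul_le_mul_of_nonneg_left (Real.add_one_le_exp _) (Real.exp_pos _).le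
      _ = Real.exp (X ω) := by rw [← Real.exp_add]; congr 1; ring
  have h0 : ∫ ω, (X ω - e + 1) ∂μ = 1 := by
    have hs : Integrable (fun ω => X ω - e) μ := hX.sub (integrable_const _)
    rw [integral_add hs (integrable_const _), integral_sub hX (integrable_const _)]
    simp [← he]
  rwa [integral_const_mul, h0, mul_one] at h

end SupForm

/-! ### Comparison and concentration for finite families. -/

section Finite

/-- Removes the smoothing error N^(c/β) as β → ∞. -/
theorem tendsto_exp_div_mul_mul (c l B : ℝ) :
    Tendsto (fun β => Real.exp (c / β * l) * B) atTop (𝓝 B) := by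
  have h0 : Tendsto (fun β => c / β * l) atTop (𝓝 (0 * l)) :=
    (tendsto_const_nhds.div_atTop tendsto_id).mul_const _
  rw [zero_mul] at h0
  have h1 := ((Real.continuous_exp.tendsto 0).comp h0).mul_const B
  rwa [Real.exp_zero, one_mul] at h1

variable {κ ι ι' : Type*} [Fintype κ] [Nonempty κ] [Fintype ι] [Fintype ι']

/-- Kahane's inequality for the exponential of the maximum of finitely many Gaussians. -/
theorem integral_exp_supForm_le_of_finite (a : κ → ι → ℝ) (b : κ → ι' → ℝ) {v c : ℝ} (hc : 0 < c)
    (hdiag : ∀ k, ∑ i, b k i * b k i - ∑ i, a k i * a k i = v)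
    (hle : ∀ k l, ∑ i, b k i * b l i - ∑ i, a k i * a l i ≤ v) :
    Real.exp (c ^ 2 * v / 2) * ∫ w, Real.exp (c * supForm a w) ∂stdGauss ι
      ≤ ∫ w, Real.exp (c * supForm b w) ∂stdGauss ι' := by
  classical
  obtain ⟨Ra, -, ha⟩ := BoundedC2.exists_bound a
  obtain ⟨Rb, -, hb⟩ := BoundedC2.exists_bound b
  set N := ∑ _k : κ, (1 : ℝ) with hN
  have hm : ∀ _k : κ, (0 : ℝ) ≤ 1 := fun _ => zero_le_one
  have hm' : ∃ _k : κ, (0 : ℝ) < 1 := ⟨Classical.arbitrary κ, one_pos⟩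
  have main : ∀ β, c ≤ β → Real.exp (c ^ 2 * v / 2) * ∫ w, Real.exp (c * supForm a w) ∂stdGauss ι
      ≤ Real.exp (c / β * Real.log N) * ∫ w, Real.exp (c * supForm b w) ∂stdGauss ι' := by
    intro β hβ
    have hβ0 : 0 < β := hc.trans_le hβ
    have hB := boundedC2_log_partitionFn hm hm' (c / β) β
    have hcmp := hB.integral_exp_le a b (c ^ 2 * v) fun z => by
      set q := fun k => gibbsWeight (fun _ : κ => (1 : ℝ)) β k z with hq
      have hq0 : ∀ k, 0 ≤ q k := fun k => gibbsWeight_nonneg hm hm' β k z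
      have hq1 : ∑ k, q k = 1 := sum_gibbsWeight hm hm' β z
      have e : ∀ k l, (∑ i, b k i * b l i - ∑ i, a k i * a l i) *
          (c / β * β * q k * (c / β * β * q l)
            + c / β * β ^ 2 * ((if k = l then q k else 0) - q k * q l))
          -- Since c/β · β = c, the first derivatives are c q_k and the Hessian is cβ (δ_kl q_k -
          -- q_k q_l). The diagonal contributes v exactly.
          = (if k = l then c * β * v * q k else 0) - c * (β - c) *
            ((∑ i, b k i * b l i - ∑ i, a k i * a l i) * (q k * q l)) := fun k l => by
        have h1 : c / β * β = c := div_mul_cancel₀ c hβ0.ne'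
        rw [pow_two, ← mul_assoc (c / β), h1]
        split_ifs with hkl
        · subst hkl; rw [hdiag]; ring
        · ring
      have e2 : ∑ k, ∑ l, (∑ i, b k i * b l i - ∑ i, a k i * a l i) * (q k * q l) ≤ v := by
        calc _ ≤ ∑ k, ∑ l, v * (q k * q l) := Finset.sum_le_sum fun k _ =>
              Finset.sum_le_sum fun l _ => mul_le_mul_of_nonneg_right (hle k l)
                (mul_nonneg (hq0 k) (hq0 l))
          _ = v * ((∑ k, q k) * ∑ l, q l) := by
              rw [Finset.sum_mul_sum]; simp only [Finset.mul_sum]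
          _ = v := by rw [hq1]; ring
      simp only [hq] at e e2 hq1
      simp only [e, Finset.sum_sub_distrib, Finset.sum_ite_eq, Finset.mem_univ, if_true,
        ← Finset.mul_sum, hq1]
      -- As c ≤ β, bounding the Gibbs average by v leaves cβv - c(β - c)v = c²v.
      have := mul_le_mul_of_nonneg_left e2 (mul_nonneg hc.le (sub_nonneg.2 hβ))
      linarith
    have hi := fun (x : κ → ι → ℝ) => hB.integrable_exp_mul x (H := fun _ => 1) continuous_const 1
        (by simp)
    have hi' := fun (x : κ → ι' → ℝ) => hB.integrable_exp_mul x (H := fun _ => 1)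
      continuous_const 1 (by simp)
    simp only [mul_one] at hi hi'
    refine (mul_le_mul_of_nonneg_left (integral_mono (integrable_exp_mul_supForm ha c) (hi a)
      fun w => ?_) (Real.exp_pos _).le).trans (hcmp.trans ?_)
    · refine Real.exp_le_exp.2 ?_
      rw [div_mul_eq_mul_div, le_div_iff₀ hβ0, mul_assoc]
      refine mul_le_mul_of_nonneg_left ?_ hc.le
      rw [mul_comm, ← le_div_iff₀' hβ0]
      exact ciSup_le fun k => by
        rw [le_div_iff₀' hβ0]
        exact le_log_partitionFn hm le_rfl _
    · rw [← integral_const_mul]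
      refine integral_mono (hi' b) ((integrable_exp_mul_supForm hb c).const_mul _) fun w => ?_
      simp only
      rw [← Real.exp_add, Real.exp_le_exp]
      have h1 := log_partitionFn_le hm hm' hβ0.le
        (fun k _ => linForms_le_supForm hb w k)
      have h2 := mul_le_mul_of_nonneg_left h1 (div_pos hc hβ0).le
      refine h2.trans (le_of_eq ?_)
      rw [mul_add, ← mul_assoc, div_mul_cancel₀ c hβ0.ne']
  exact ge_of_tendsto (tendsto_exp_div_mul_mul _ _ _) ((eventually_ge_atTop c).mono main)

/-- Concentration of the maximum of finitely many Gaussians, in exponential form. -/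
theorem integral_exp_supForm_mul_le_of_finite (a : κ → ι → ℝ) {L c : ℝ} (hc : 0 < c)
    (hL : ∀ k l, ∑ i, a k i * a l i ≤ L) :
    (∫ w, Real.exp (c * supForm a w) ∂stdGauss ι) * ∫ w, Real.exp (-c * supForm a w) ∂stdGauss ι
      ≤ Real.exp (c ^ 2 * L) := by
  classical
  obtain ⟨Ra, -, ha⟩ := BoundedC2.exists_bound a
  set N := Fintype.card κ with hN
  let m1 : κ ⊕ κ → ℝ := Sum.elim (fun _ => 1) fun _ => 0
  let m2 : κ ⊕ κ → ℝ := Sum.elim (fun _ => 0) fun _ => 1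
  let k0 := Classical.arbitrary κ
  have h1 : ∀ k, 0 ≤ m1 k := by rintro (k | k) <;> simp [m1]
  have h1' : ∃ k, 0 < m1 k := ⟨Sum.inl k0, by simp [m1]⟩
  have h2 : ∀ k, 0 ≤ m2 k := by rintro (k | k) <;> simp [m2]
  have h2' : ∃ k, 0 < m2 k := ⟨Sum.inr k0, by simp [m2]⟩
  have s2 : ∑ k, m2 k = N := by simp [m2, hN]
  -- `x` is the process with an independent copy, `y` the process used twice. Their covariances
  -- differ only in the two off-diagonal blocks, by Cov a.
  let x : κ ⊕ κ → ι ⊕ ι → ℝ := Sum.elim (fun k => Sum.elim (a k) 0) fun k => Sum.elim 0 (a k)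
  let y : κ ⊕ κ → ι → ℝ := Sum.elim a a
  have main : ∀ β, 0 < β → (∫ w, Real.exp (c * supForm a w) ∂stdGauss ι)
      * ∫ w, Real.exp (-c * supForm a w) ∂stdGauss ι
      ≤ Real.exp (c / β * Real.log N) * Real.exp (c ^ 2 * L) := by
    intro β hβ0
    have hcβ : c / β * β = c := div_mul_cancel₀ c hβ0.ne'
    have hB := (boundedC2_log_partitionFn h1 h1' (c / β) β).add
      (boundedC2_log_partitionFn h2 h2' (-(c / β)) β)
    -- The Hessian of log Z₁ - log Z₂ has no cross-block entries, and the gradients have opposite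
    -- signs. The sum is thus -2c² times an average of Cov a, hence at least -2c²L.
    have hcmp := hB.integral_exp_le x y (-(2 * (c ^ 2 * L))) fun z => by
      set q := fun k => gibbsWeight m1 β (Sum.inl k) z with hq
      set r := fun k => gibbsWeight m2 β (Sum.inr k) z with hr
      have hq0 : ∀ k, 0 ≤ q k := fun k => gibbsWeight_nonneg h1 h1' β _ z
      have hr0 : ∀ k, 0 ≤ r k := fun k => gibbsWeight_nonneg h2 h2' β _ z
      have hqz : ∀ k, gibbsWeight m1 β (Sum.inr k) z = 0 := fun k => by simp [gibbsWeight, m1]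
      have hrz : ∀ k, gibbsWeight m2 β (Sum.inl k) z = 0 := fun k => by simp [gibbsWeight, m2]
      have hq1 : ∑ k, q k = 1 := by
        simpa [Fintype.sum_sum_type, hqz] using sum_gibbsWeight h1 h1' β z
      have hr1 : ∑ k, r k = 1 := by
        simpa [Fintype.sum_sum_type, hrz] using sum_gibbsWeight h2 h2' β z
      have e2 : ∑ k, ∑ l, (∑ i, a k i * a l i) * (q k * r l) ≤ L := by
        calc _ ≤ ∑ k, ∑ l, L * (q k * r l) := Finset.sum_le_sum fun k _ =>
              Finset.sum_le_sum fun l _ => mul_le_mul_of_nonneg_right (hL k l)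
                (mul_nonneg (hq0 k) (hr0 l))
          _ = L * ((∑ k, q k) * ∑ l, r l) := by
              rw [Finset.sum_mul_sum]; simp only [Finset.mul_sum]
          _ = L := by rw [hq1, hr1]; ring
      have e3 : ∑ k, ∑ l, (∑ i, a k i * a l i) * (r k * q l)
          = ∑ k, ∑ l, (∑ i, a k i * a l i) * (q k * r l) := by
        rw [Finset.sum_comm]
        refine Finset.sum_congr rfl fun k _ => Finset.sum_congr rfl fun l _ => ?_
        rw [mul_comm (r l)]
        congr 1
        exact Finset.sum_congr rfl fun i _ => mul_comm _ _
      have e4 : ∀ A u t : ℝ, A * (c / β * β * u * (-(c / β) * β * t)) = -c ^ 2 * (A * (u * t)) :=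
        fun A u t => by
          rw [neg_mul, hcβ]; ring
      have e5 : ∀ A u t : ℝ, A * (-(c / β) * β * u * (c / β * β * t)) = -c ^ 2 * (A * (u * t)) :=
        fun A u t => by
          rw [neg_mul, hcβ]; ring
      simp only [Fintype.sum_sum_type, x, y, Sum.elim_inl, Sum.elim_inr, hqz, hrz, Pi.zero_apply,
        mul_zero, zero_mul, Finset.sum_const_zero, add_zero, zero_add, sub_self, sub_zero,
        reduceCtorEq, if_false, Finset.sum_add_distrib]
      simp only [hq, hr] at e2 e3
      simp only [e4, e5, ← Finset.mul_sum, e3]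
      nlinarith [sq_nonneg c]
    have hi := hB.integrable_exp_mul x (H := fun _ => 1) continuous_const 1 (by simp)
    simp only [mul_one] at hi
    -- On the duplicated process the two log-partition functions cancel, so its expectation is
    -- exactly 1.
    have hy : ∀ w, Real.exp (c / β * Real.log (partitionFn m1 β (linForms y w))
        + -(c / β) * Real.log (partitionFn m2 β (linForms y w))) = 1 := fun w => by
      rw [Real.exp_eq_one_iff]
      have : partitionFn m1 β (linForms y w) = partitionFn m2 β (linForms y w) := by
        simp [partitionFn, m1, m2, linForms, y]
      rw [this]; ring
    simp only [hy, integral_const, probReal_univ, smul_eq_mul, mul_one] at hcmp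
    rw [show -(2 * (c ^ 2 * L)) / 2 = -(c ^ 2 * L) by ring, Real.exp_neg,
      inv_mul_le_iff₀ (Real.exp_pos _), mul_one] at hcmp
    refine le_trans ?_ (mul_le_mul_of_nonneg_left hcmp (Real.exp_pos _).le)
    rw [← integral_mul_stdGauss_sum, ← integral_const_mul]
    refine integral_mono_of_nonneg (ae_of_all _ fun w => (mul_pos (Real.exp_pos _)
      (Real.exp_pos _)).le) (hi.const_mul _) (ae_of_all _ fun w => ?_)
    simp only
    rw [← Real.exp_add, ← Real.exp_add, Real.exp_le_exp]
    have hxl : ∀ k, linForms x w (Sum.inl k) = linForms a (fun i => w (Sum.inl i)) k := fun k => by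
      simp [linForms, x]
    have hxr : ∀ k, linForms x w (Sum.inr k) = linForms a (fun i => w (Sum.inr i)) k := fun k => by
      simp [linForms, x]
    have b1 : β * supForm a (fun i => w (Sum.inl i))
        ≤ Real.log (partitionFn m1 β (linForms x w)) := by
      rw [← le_div_iff₀' hβ0]
      exact ciSup_le fun k => by
        rw [le_div_iff₀' hβ0, ← hxl]
        exact le_log_partitionFn h1 (by simp [m1]) _
    have b2 := log_partitionFn_le h2 h2' hβ0.le (z := linForms x w)
      (M := supForm a (fun i => w (Sum.inr i))) fun k hk => by
        cases k with
        | inl k => simp [m2] at hk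
        | inr k => rw [hxr]; exact linForms_le_supForm ha _ k
    rw [s2] at b2
    have hpos := (div_pos hc hβ0).le
    have c1 := mul_le_mul_of_nonneg_left b1 hpos
    have c2 := mul_le_mul_of_nonneg_left b2 hpos
    rw [← mul_assoc, hcβ] at c1
    rw [mul_add, ← mul_assoc, hcβ] at c2
    linarith
  exact ge_of_tendsto (tendsto_exp_div_mul_mul _ _ _) ((eventually_gt_atTop 0).mono main)

end Finite

/-! ### Passage from finite families to arbitrary index sets. -/

section General

variable {I ι ι' : Type*} [Fintype ι] [Fintype ι'] {a : I → ι → ℝ} {b : I → ι' → ℝ} {R : ℝ}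

theorem supForm_comp_le {K : Type*} [Nonempty K] (ha : ∀ i j, |a i j| ≤ R) (u : K → I) (w : ι → ℝ) :
    supForm (fun k => a (u k)) w ≤ supForm a w :=
  ciSup_le fun k => linForms_le_supForm ha w (u k)

variable [Nonempty I]

/-- A dense sequence in the range of a, a separable set, realises the supremum for every w at once.
Indexing by `Fin (n + 1)` keeps each subfamily nonempty. -/
theorem exists_seq_tendsto_supForm (ha : ∀ i j, |a i j| ≤ R) :
    ∃ u : ℕ → I, ∀ w, Tendsto (fun n : ℕ => supForm (fun k : Fin (n + 1) => a (u k)) w) atTop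
      (𝓝 (supForm a w)) := by
  have : Nonempty (Set.range a) := Set.nonempty_coe_sort.2 (Set.range_nonempty a)
  choose u hu using fun n => (TopologicalSpace.denseSeq (Set.range a) n).2
  refine ⟨u, fun w => tendsto_order.2 ⟨fun y hy => ?_, fun y hy => ?_⟩⟩
  · obtain ⟨i, hi⟩ := exists_lt_of_lt_ciSup hy
    have hopen : IsOpen {x : Set.range a | y < ∑ j, w j * x.1 j} :=
      isOpen_lt continuous_const (continuous_finsetSum _ fun j _ =>
        continuous_const.mul ((continuous_apply j).comp continuous_subtype_val))
    obtain ⟨_, hx, n, rfl⟩ := (TopologicalSpace.denseRange_denseSeq (Set.range a)).inter_open_nonempty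
      _ hopen ⟨⟨a i, i, rfl⟩, hi⟩
    refine (eventually_ge_atTop n).mono fun N hN => ?_
    have hx' : y < linForms (fun k : Fin (N + 1) => a (u k)) w ⟨n, Nat.lt_succ_of_le hN⟩ := by
      simpa [linForms, hu] using hx
    exact hx'.trans_le (linForms_le_supForm (fun (k : Fin (N + 1)) j => ha (u k) j) w _)
  · refine Eventually.of_forall fun N => lt_of_le_of_lt (ciSup_le fun k => ?_) hy
    exact linForms_le_supForm ha w (u k)

/-- Finite subfamilies determine the exponential moments of the supremum. -/
theorem integral_exp_supForm_le_of_forall (ha : ∀ i j, |a i j| ≤ R) (c B : ℝ)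
    (h : ∀ (n : ℕ) (u : Fin (n + 1) → I),
      ∫ w, Real.exp (c * supForm (fun k => a (u k)) w) ∂stdGauss ι ≤ B) :
    ∫ w, Real.exp (c * supForm a w) ∂stdGauss ι ≤ B := by
  obtain ⟨u, hu⟩ := exists_seq_tendsto_supForm ha
  refine le_of_tendsto (tendsto_integral_of_dominated_convergence
    (F := fun (n : ℕ) w => Real.exp (c * supForm (fun k : Fin (n + 1) => a (u k)) w))
    (fun w => Real.exp (|c| * R * ∑ j, |w j|)) (fun n => ?_) (integrable_exp_sum_abs _)
    (fun n => ae_of_all _ fun w => ?_) (ae_of_all _ fun w => ?_))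
    (Eventually.of_forall fun n => h n fun k => u k)
  · exact (integrable_exp_mul_supForm (fun (k : Fin (n + 1)) j => ha (u k) j) c).1
  · rw [Real.norm_eq_abs, abs_of_pos (Real.exp_pos _)]
    exact exp_mul_supForm_le (fun (k : Fin (n + 1)) j => ha (u k) j) c w
  · exact (Real.continuous_exp.tendsto _).comp ((hu w).const_mul c)

/-- Kahane's inequality for the exponential of the supremum of a Gaussian process. -/
theorem integral_exp_supForm_le (ha : ∀ i j, |a i j| ≤ R) (hb : ∀ i j, |b i j| ≤ R) {v c : ℝ}
    (hc : 0 < c) (hdiag : ∀ k, ∑ i, b k i * b k i - ∑ i, a k i * a k i = v)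
    (hle : ∀ k l, ∑ i, b k i * b l i - ∑ i, a k i * a l i ≤ v) :
    Real.exp (c ^ 2 * v / 2) * ∫ w, Real.exp (c * supForm a w) ∂stdGauss ι
      ≤ ∫ w, Real.exp (c * supForm b w) ∂stdGauss ι' := by
  rw [← le_div_iff₀' (Real.exp_pos _)]
  refine integral_exp_supForm_le_of_forall ha c _ fun n u => ?_
  rw [le_div_iff₀' (Real.exp_pos _)]
  refine (integral_exp_supForm_le_of_finite (fun k => a (u k)) (fun k => b (u k)) hc
    (fun k => hdiag _) fun k l => hle _ _).trans ?_
  refine integral_mono (integrable_exp_mul_supForm (fun k j => hb (u k) j) c)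
    (integrable_exp_mul_supForm hb c) fun w => Real.exp_le_exp.2 ?_
  exact mul_le_mul_of_nonneg_left (supForm_comp_le hb u w) hc.le

/-- Sub-Gaussian concentration of the supremum of a Gaussian process. -/
theorem integral_exp_supForm_le_exp (ha : ∀ i j, |a i j| ≤ R) {L c : ℝ} (hc : 0 < c)
    (hL : ∀ k l, ∑ i, a k i * a l i ≤ L) :
    ∫ w, Real.exp (c * supForm a w) ∂stdGauss ι
      ≤ Real.exp (c * ∫ w, supForm a w ∂stdGauss ι + c ^ 2 * L) := by
  refine integral_exp_supForm_le_of_forall ha c _ fun n u => ?_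
  have ha' := fun (k : Fin (n + 1)) j => ha (u k) j
  have h1 := integral_exp_supForm_mul_le_of_finite (fun k => a (u k)) hc fun k l => hL (u k) (u l)
  -- Jensen bounds the factor with -c below by exp(-c E sup), which turns the product estimate into
  -- a bound on the other factor.
  have h2 := exp_integral_le_integral_exp ((integrable_supForm ha').const_mul (-c))
    (integrable_exp_mul_supForm ha' (-c))
  rw [integral_const_mul] at h2
  have h3 : ∫ w, supForm (fun k => a (u k)) w ∂stdGauss ι ≤ ∫ w, supForm a w ∂stdGauss ι :=
    integral_mono (integrable_supForm ha') (integrable_supForm ha) fun w => supForm_comp_le ha u w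
  have h0 : 0 ≤ ∫ w, Real.exp (c * supForm (fun k => a (u k)) w) ∂stdGauss ι :=
    integral_nonneg fun w => (Real.exp_pos _).le
  have h4 := (mul_le_mul_of_nonneg_left h2 h0).trans h1
  rw [neg_mul, Real.exp_neg, ← div_eq_mul_inv, div_le_iff₀ (Real.exp_pos _), ← Real.exp_add] at h4
  exact h4.trans (Real.exp_le_exp.2 (by nlinarith))

end General

/-! ### Small-parameter limit of log-moments. -/

section Moments

variable {Ω : Type*} [MeasurableSpace Ω] {μ : Measure Ω} [IsProbabilityMeasure μ]

/-- The cumulant generating function vanishes at 0 and its derivative there is the mean. -/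
theorem tendsto_log_integral_exp {X : Ω → ℝ}
    (hX : ∀ c : ℝ, Integrable (fun ω => Real.exp (c * X ω)) μ) :
    Tendsto (fun c => 1 / c * Real.log (∫ ω, Real.exp (c * X ω) ∂μ)) (𝓝[>] 0)
      (𝓝 (∫ ω, X ω ∂μ)) := by
  have hset : integrableExpSet X μ = Set.univ := Set.eq_univ_of_forall hX
  have h0 : (0 : ℝ) ∈ interior (integrableExpSet X μ) := by simp [hset]
  have hd := (analyticAt_cgf h0).differentiableAt.hasDerivAt
  rw [deriv_cgf_zero h0, probReal_univ, div_one] at hd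
  have h := hd.tendsto_slope_zero_right
  refine h.congr fun c => ?_
  simp [cgf, mgf]

end Moments

/-! ### Families of Gaussian vectors as one long Gaussian vector. -/

section Transfer

variable {ι ι' : Type*} [Fintype ι] [Fintype ι']

theorem integral_pi_stdGauss (f : (ι → ι' → ℝ) → ℝ) :
    ∫ g, f g ∂(Measure.pi fun _ : ι => stdGauss ι')
      = ∫ w : ι × ι' → ℝ, f (fun i j => w (i, j)) ∂stdGauss (ι × ι') :=
  ((measurePreserving_curry_stdGauss (ι := ι) (ι' := ι')).integral_comp
    (MeasurableEquiv.curry ι ι' ℝ).measurableEmbedding f).symm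

theorem integrable_pi_stdGauss_iff (f : (ι → ι' → ℝ) → ℝ) :
    Integrable f (Measure.pi fun _ : ι => stdGauss ι')
      ↔ Integrable (fun w : ι × ι' → ℝ => f fun i j => w (i, j)) (stdGauss (ι × ι')) :=
  ((measurePreserving_curry_stdGauss (ι := ι) (ι' := ι')).integrable_comp_emb
    (MeasurableEquiv.curry ι ι' ℝ).measurableEmbedding).symm

end Transfer

/-! ### The covariance inequalities and separable suprema. -/

section Inequalities

/-- Induction: with P the product so far, (1 - P)(1 - r) ≥ 0 gives P + r ≤ Pr + 1. -/
theorem sum_le_prod_add {α : Type*} (s : Finset α) (r : α → ℝ) (hr : ∀ j, |r j| ≤ 1) :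
    ∑ j ∈ s, r j ≤ ∏ j ∈ s, r j + (s.card - 1) := by
  classical
  induction s using Finset.induction_on with
  | empty => simp
  | insert a s ha ih =>
    rw [Finset.sum_insert ha, Finset.prod_insert ha, Finset.card_insert_of_notMem ha]
    have h1 : |∏ j ∈ s, r j| ≤ 1 := by
      rw [Finset.abs_prod]
      exact Finset.prod_le_one (fun _ _ => abs_nonneg _) fun j _ => hr j
    have h2 := mul_nonneg (sub_nonneg.2 (abs_le.1 h1).2) (sub_nonneg.2 (abs_le.1 (hr a)).2)
    push_cast
    linarith

/-- AM-GM for the numbers |r_j|^p; evenness of p removes the absolute values. -/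
theorem prod_le_sum_pow_div {p : ℕ} (hp : Even p) (hp0 : 0 < p) (r : Fin p → ℝ) :
    ∏ j, r j ≤ (∑ j, r j ^ p) / p := by
  have hp' : (0 : ℝ) < p := Nat.cast_pos.2 hp0
  have h := Real.geom_mean_le_arith_mean_weighted Finset.univ (fun _ : Fin p => (p : ℝ)⁻¹)
    (fun j => |r j| ^ p) (fun _ _ => by positivity) (by simp [hp'.ne'])
    fun _ _ => by positivity
  simp only [Real.pow_rpow_inv_natCast (abs_nonneg _) hp0.ne'] at h
  simp only [hp.pow_abs, ← Finset.mul_sum] at h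
  refine (le_abs_self _).trans ?_
  rw [Finset.abs_prod, div_eq_inv_mul]
  exact h

theorem sSup_sum_pi {α : Type*} {p : ℕ} (S : Fin p → Set α) (hne : ∀ j, (S j).Nonempty)
    (f : Fin p → α → ℝ) (hb : ∀ j, BddAbove (f j '' S j)) :
    sSup ((fun x : Fin p → α => ∑ j, f j (x j)) '' Set.univ.pi S) = ∑ j, sSup (f j '' S j) := by
  have hle : ∀ x ∈ Set.univ.pi S, ∑ j, f j (x j) ≤ ∑ j, sSup (f j '' S j) := fun x hx =>
    Finset.sum_le_sum fun j _ => le_csSup (hb j) ⟨x j, hx j trivial, rfl⟩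
  refine le_antisymm (csSup_le ((Set.univ_pi_nonempty_iff.2 hne).image _) ?_) ?_
  · rintro _ ⟨x, hx, rfl⟩
    exact hle x hx
  · refine le_of_forall_pos_le_add fun ε hε => ?_
    -- Splitting ε into p + 1 parts avoids a separate case p = 0.
    have hp' : (0 : ℝ) < p + 1 := by positivity
    have hx : ∀ j, ∃ x ∈ S j, sSup (f j '' S j) - ε / (p + 1) < f j x := fun j => by
      obtain ⟨_, ⟨x, hx, rfl⟩, h⟩ := exists_lt_of_lt_csSup ((hne j).image (f j))
        (sub_lt_self _ (div_pos hε hp'))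
      exact ⟨x, hx, h⟩
    choose x hx hlt using hx
    have h1 : ∑ j, f j (x j) ≤ sSup ((fun x : Fin p → α => ∑ j, f j (x j)) '' Set.univ.pi S) :=
      le_csSup ⟨_, by rintro _ ⟨y, hy, rfl⟩; exact hle y hy⟩ ⟨x, fun j _ => hx j, rfl⟩
    have h2 : ∑ j, (sSup (f j '' S j) - ε / (p + 1)) ≤ ∑ j, f j (x j) :=
      Finset.sum_le_sum fun j _ => (hlt j).le
    rw [Finset.sum_sub_distrib, Finset.sum_const, Finset.card_univ, Fintype.card_fin,
      nsmul_eq_mul] at h2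
    have h3 : (p : ℝ) * (ε / (p + 1)) ≤ ε := by
      rw [mul_div_assoc', div_le_iff₀ hp']
      nlinarith
    linarith

variable {n : ℕ} {x y : EuclideanSpace ℝ (Fin n)}

theorem abs_coord_le_of_mem_sphere (hx : x ∈ Metric.sphere (0 : EuclideanSpace ℝ (Fin n)) 1)
    (i : Fin n) : |x i| ≤ 1 := by
  rw [← mem_sphere_zero_iff_norm.1 hx]
  exact PiLp.norm_apply_le x i

theorem abs_dot_le_of_mem_sphere (hx : x ∈ Metric.sphere (0 : EuclideanSpace ℝ (Fin n)) 1)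
    (hy : y ∈ Metric.sphere (0 : EuclideanSpace ℝ (Fin n)) 1) : |∑ i, x i * y i| ≤ 1 := by
  have h := abs_real_inner_le_norm y x
  rw [mem_sphere_zero_iff_norm.1 hx, mem_sphere_zero_iff_norm.1 hy, mul_one] at h
  simpa [PiLp.inner_apply] using h

theorem dot_self_of_mem_sphere (hx : x ∈ Metric.sphere (0 : EuclideanSpace ℝ (Fin n)) 1) :
    ∑ i, x i * x i = 1 := by
  have h := real_inner_self_eq_norm_sq x
  rw [mem_sphere_zero_iff_norm.1 hx, one_pow, PiLp.inner_apply] at h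
  simpa only [RCLike.inner_apply, conj_trivial] using h

theorem sum_prod_mul_prod {p : ℕ} (x y : Fin p → EuclideanSpace ℝ (Fin n)) :
    ∑ i : Fin p → Fin n, (∏ j, x j (i j)) * ∏ j, y j (i j) = ∏ j, ∑ i, x j i * y j i := by
  simp only [← Finset.prod_mul_distrib]
  rw [Finset.prod_univ_sum, Fintype.piFinset_univ]

end Inequalities

/-! ### The concrete processes, their covariances and the comparison bounds. -/

section Models

variable {p n : ℕ}

/-- Coefficients of the multipartite form. -/
noncomputable def multiCoef (S : Fin p → Set (EuclideanSpace ℝ (Fin n))) (x : Set.univ.pi S)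
    (i : Fin p → Fin n) : ℝ := ∏ j, x.1 j (i j)

/-- Coefficients of the single-partite form. -/
noncomputable def singleCoef (p : ℕ) (T : Set (EuclideanSpace ℝ (Fin n))) (x : T)
    (i : Fin p → Fin n) : ℝ := ∏ j, x.1 (i j)

/-- Coefficients of the linear form on `ℝⁿ`. -/
def linearCoef (T : Set (EuclideanSpace ℝ (Fin n))) (x : T) (i : Fin n) : ℝ := x.1 i

/-- Coefficients of the sum of `p` linear forms. -/
def linearSumCoef (S : Fin p → Set (EuclideanSpace ℝ (Fin n))) (x : Set.univ.pi S)
    (q : Fin p × Fin n) : ℝ := x.1 q.1 q.2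

/-- Coefficients of the decoupled form. -/
noncomputable def decoupledCoef (S : Fin p → Set (EuclideanSpace ℝ (Fin n))) (x : Set.univ.pi S)
    (q : Fin p × (Fin p → Fin n)) : ℝ := (√(p : ℝ))⁻¹ * ∏ k, x.1 q.1 (q.2 k)

variable (S : Fin p → Set (EuclideanSpace ℝ (Fin n))) (T : Set (EuclideanSpace ℝ (Fin n)))

theorem multiMax_eq_supForm : multiMax S = supForm (multiCoef S) := by
  ext A
  rw [multiMax, sSup_image']
  rfl

theorem singleMax_eq_supForm : singleMax (p := p) T = supForm (singleCoef p T) := by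
  ext A
  rw [singleMax, sSup_image']
  rfl

theorem linearMax_eq_supForm : linearMax T = supForm (linearCoef T) := by
  ext g
  rw [linearMax, sSup_image']
  rfl

theorem linearSumMax_eq_supForm (w : Fin p × Fin n → ℝ) :
    linearSumMax S (fun j i => w (j, i)) = supForm (linearSumCoef S) w := by
  rw [linearSumMax, sSup_image']
  simp only [supForm, linForms, Fintype.sum_prod_type]
  rfl

theorem decoupledMax_eq_supForm (w : Fin p × (Fin p → Fin n) → ℝ) :
    (√(p : ℝ))⁻¹ * decoupledMax S (fun j i => w (j, i)) = supForm (decoupledCoef S) w := by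
  rw [decoupledMax, sSup_image', Real.mul_iSup_of_nonneg (by positivity)]
  simp only [supForm, linForms, decoupledCoef, Fintype.sum_prod_type, tensorForm, Finset.mul_sum,
    mul_left_comm]

variable {S T} (hS : ∀ j, S j ⊆ Metric.sphere 0 1) (hne : ∀ j, (S j).Nonempty)
  (hT : T ⊆ Metric.sphere 0 1) (hTne : T.Nonempty)

include hne in
theorem nonempty_univ_pi : Nonempty (Set.univ.pi S) :=
  Set.nonempty_coe_sort.2 (Set.univ_pi_nonempty_iff.2 hne)

theorem abs_prod_le_one {α : Type*} [Fintype α] {r : α → ℝ} (h : ∀ j, |r j| ≤ 1) :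
    |∏ j, r j| ≤ 1 := by
  rw [Finset.abs_prod]
  exact Finset.prod_le_one (fun _ _ => abs_nonneg _) fun j _ => h j

include hS in
theorem mem_sphere_of_univ_pi (x : Set.univ.pi S) (j : Fin p) :
    x.1 j ∈ Metric.sphere (0 : EuclideanSpace ℝ (Fin n)) 1 := hS j (x.2 j trivial)

include hS in
theorem abs_multiCoef_le (x : Set.univ.pi S) (i) : |multiCoef S x i| ≤ 1 :=
  abs_prod_le_one fun j => abs_coord_le_of_mem_sphere (mem_sphere_of_univ_pi hS x j) _

include hT in
theorem abs_singleCoef_le (x : T) (i) : |singleCoef p T x i| ≤ 1 :=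
  abs_prod_le_one fun _ => abs_coord_le_of_mem_sphere (hT x.2) _

include hT in
theorem abs_linearCoef_le (x : T) (i) : |linearCoef T x i| ≤ 1 :=
  abs_coord_le_of_mem_sphere (hT x.2) i

include hS in
theorem abs_linearSumCoef_le (x : Set.univ.pi S) (q) : |linearSumCoef S x q| ≤ 1 :=
  abs_coord_le_of_mem_sphere (mem_sphere_of_univ_pi hS x q.1) _

include hS in
theorem abs_decoupledCoef_le (x : Set.univ.pi S) (q) : |decoupledCoef S x q| ≤ 1 := by
  -- The index q itself witnesses p ≥ 1.
  have hp : (1 : ℝ) ≤ √p := Real.one_le_sqrt.2 (Nat.one_le_cast.2 (Fin.pos q.1))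
  rw [decoupledCoef, abs_mul, abs_of_nonneg (inv_nonneg.2 (Real.sqrt_nonneg _)), ← one_mul (1 : ℝ)]
  exact mul_le_mul (inv_le_one_of_one_le₀ hp) (abs_prod_le_one fun j =>
    abs_coord_le_of_mem_sphere (mem_sphere_of_univ_pi hS x q.1) _) (abs_nonneg _) zero_le_one

theorem sum_multiCoef_mul (x y : Set.univ.pi S) :
    ∑ i, multiCoef S x i * multiCoef S y i = ∏ j, ∑ i, x.1 j i * y.1 j i :=
  sum_prod_mul_prod x.1 y.1

theorem sum_linearSumCoef_mul (x y : Set.univ.pi S) :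
    ∑ q, linearSumCoef S x q * linearSumCoef S y q = ∑ j, ∑ i, x.1 j i * y.1 j i :=
  Fintype.sum_prod_type _

/-- The factor 1/√p in the coefficients normalises the variance on unit vectors to 1, matching the
multipartite form on the diagonal. -/
theorem sum_decoupledCoef_mul (x y : Set.univ.pi S) :
    ∑ q, decoupledCoef S x q * decoupledCoef S y q = (∑ j, (∑ i, x.1 j i * y.1 j i) ^ p) / p := by
  have h : (√(p : ℝ))⁻¹ * (√(p : ℝ))⁻¹ = (p : ℝ)⁻¹ := by
    rw [← mul_inv, Real.mul_self_sqrt (Nat.cast_nonneg p)]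
  simp only [decoupledCoef, mul_mul_mul_comm, h, ← Finset.mul_sum, Fintype.sum_prod_type]
  rw [div_eq_inv_mul]
  congr 1
  refine Finset.sum_congr rfl fun j _ => ?_
  rw [sum_prod_mul_prod (fun _ => x.1 j) (fun _ => y.1 j)]
  simp

theorem xiLower_eq (S : Fin p → Set (EuclideanSpace ℝ (Fin n))) (c : ℝ) : xiLower S c = 1 / √(n : ℝ) * (1 / c * Real.log
    (∫ A, Real.exp (c * ((√(p : ℝ))⁻¹ * decoupledMax S A)) ∂gaussTensors p n)) := by
  simp only [xiLower, mul_assoc, mul_left_comm]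

include hS hne

theorem integrable_multiMax : Integrable (multiMax S) (gaussTensor p n) := by
  have := nonempty_univ_pi hne
  rw [multiMax_eq_supForm]
  exact integrable_supForm (abs_multiCoef_le hS)

theorem integrable_exp_multiMax (c : ℝ) :
    Integrable (fun A => Real.exp (c * multiMax S A)) (gaussTensor p n) := by
  have := nonempty_univ_pi hne
  rw [multiMax_eq_supForm]
  exact integrable_exp_mul_supForm (abs_multiCoef_le hS) c

theorem integrable_linearSumMax : Integrable (linearSumMax S) (gaussVectors p n) := by
  have := nonempty_univ_pi hne
  refine (integrable_pi_stdGauss_iff _).2 ?_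
  simp only [linearSumMax_eq_supForm]
  exact integrable_supForm (abs_linearSumCoef_le hS)

theorem integrable_exp_linearSumMax (c : ℝ) :
    Integrable (fun g => Real.exp (c * linearSumMax S g)) (gaussVectors p n) := by
  have := nonempty_univ_pi hne
  refine (integrable_pi_stdGauss_iff _).2 ?_
  simp only [linearSumMax_eq_supForm]
  exact integrable_exp_mul_supForm (abs_linearSumCoef_le hS) c

theorem integrable_mul_decoupledMax :
    Integrable (fun A => (√(p : ℝ))⁻¹ * decoupledMax S A) (gaussTensors p n) := by
  have := nonempty_univ_pi hne
  refine (integrable_pi_stdGauss_iff _).2 ?_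
  simp only [decoupledMax_eq_supForm]
  exact integrable_supForm (abs_decoupledCoef_le hS)

theorem integrable_decoupledMax (hp0 : 0 < p) :
    Integrable (decoupledMax S) (gaussTensors p n) := by
  have h := (integrable_mul_decoupledMax hS hne).const_mul √(p : ℝ)
  have hp : √(p : ℝ) ≠ 0 := (Real.sqrt_pos.2 (Nat.cast_pos.2 hp0)).ne'
  simpa [mul_inv_cancel_left₀ hp] using h

theorem integrable_exp_mul_decoupledMax (c : ℝ) :
    Integrable (fun A => Real.exp (c * ((√(p : ℝ))⁻¹ * decoupledMax S A))) (gaussTensors p n) := by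
  have := nonempty_univ_pi hne
  refine (integrable_pi_stdGauss_iff _).2 ?_
  simp only [decoupledMax_eq_supForm]
  exact integrable_exp_mul_supForm (abs_decoupledCoef_le hS) c

/-- Kahane's comparison with v = p - 1: on the diagonal all overlaps are 1 and the variances are p
and 1. -/
theorem exp_mul_integral_exp_multiMax_le {c : ℝ} (hc : 0 < c) :
    Real.exp (c ^ 2 * ((p : ℝ) - 1) / 2) * ∫ A, Real.exp (c * multiMax S A) ∂gaussTensor p n
      ≤ ∫ g, Real.exp (c * linearSumMax S g) ∂gaussVectors p n := by
  have := nonempty_univ_pi hne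
  have e : ∫ g, Real.exp (c * linearSumMax S g) ∂gaussVectors p n
      = ∫ w, Real.exp (c * supForm (linearSumCoef S) w) ∂stdGauss (Fin p × Fin n) := by
    refine (integral_pi_stdGauss _).trans ?_
    simp only [linearSumMax_eq_supForm]
  rw [e, multiMax_eq_supForm]
  refine integral_exp_supForm_le (abs_multiCoef_le hS) (abs_linearSumCoef_le hS) hc
    (fun x => ?_) fun x y => ?_
  · rw [sum_multiCoef_mul, sum_linearSumCoef_mul]
    simp [dot_self_of_mem_sphere (mem_sphere_of_univ_pi hS x _)]
  · rw [sum_multiCoef_mul, sum_linearSumCoef_mul]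
    have := sum_le_prod_add Finset.univ (fun j => ∑ i, x.1 j i * y.1 j i) fun j =>
      abs_dot_le_of_mem_sphere (mem_sphere_of_univ_pi hS x j) (mem_sphere_of_univ_pi hS y j)
    rw [Finset.card_univ, Fintype.card_fin] at this
    linarith

theorem integral_exp_decoupledMax_le (hp : Even p) (hp0 : 0 < p) {c : ℝ} (hc : 0 < c) :
    ∫ A, Real.exp (c * ((√(p : ℝ))⁻¹ * decoupledMax S A)) ∂gaussTensors p n
      ≤ ∫ A, Real.exp (c * multiMax S A) ∂gaussTensor p n := by
  have := nonempty_univ_pi hne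
  have e : ∫ A, Real.exp (c * ((√(p : ℝ))⁻¹ * decoupledMax S A)) ∂gaussTensors p n
      = ∫ w, Real.exp (c * supForm (decoupledCoef S) w) ∂stdGauss (Fin p × (Fin p → Fin n)) := by
    refine (integral_pi_stdGauss _).trans ?_
    simp only [decoupledMax_eq_supForm]
  rw [e, multiMax_eq_supForm]
  have hp' : (p : ℝ) ≠ 0 := Nat.cast_ne_zero.2 hp0.ne'
  have h := integral_exp_supForm_le (v := 0) (abs_decoupledCoef_le hS) (abs_multiCoef_le hS) hc
    (fun x => ?_) fun x y => ?_
  · rwa [mul_zero, zero_div, Real.exp_zero, one_mul] at h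
  · rw [sum_multiCoef_mul, sum_decoupledCoef_mul]
    simp [dot_self_of_mem_sphere (mem_sphere_of_univ_pi hS x _), hp']
  · rw [sum_multiCoef_mul, sum_decoupledCoef_mul, sub_nonpos]
    exact prod_le_sum_pow_div hp hp0 _

/-- Concentration with L = p, as each of the p overlaps is at most 1. -/
theorem integral_exp_linearSumMax_le {c : ℝ} (hc : 0 < c) :
    ∫ g, Real.exp (c * linearSumMax S g) ∂gaussVectors p n
      ≤ Real.exp (c * ∫ g, linearSumMax S g ∂gaussVectors p n + c ^ 2 * p) := by
  have := nonempty_univ_pi hne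
  have e : ∫ g, Real.exp (c * linearSumMax S g) ∂gaussVectors p n
      = ∫ w, Real.exp (c * supForm (linearSumCoef S) w) ∂stdGauss (Fin p × Fin n) := by
    refine (integral_pi_stdGauss _).trans ?_
    simp only [linearSumMax_eq_supForm]
  have e' : ∫ g, linearSumMax S g ∂gaussVectors p n
      = ∫ w, supForm (linearSumCoef S) w ∂stdGauss (Fin p × Fin n) := by
    refine (integral_pi_stdGauss _).trans ?_
    simp only [linearSumMax_eq_supForm]
  rw [e, e']
  refine integral_exp_supForm_le_exp (abs_linearSumCoef_le hS) hc fun x y => ?_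
  rw [sum_linearSumCoef_mul]
  have h := Finset.sum_le_card_nsmul Finset.univ (fun j => ∑ i, x.1 j i * y.1 j i) 1 fun j _ =>
    (abs_le.1 (abs_dot_le_of_mem_sphere (mem_sphere_of_univ_pi hS x j)
      (mem_sphere_of_univ_pi hS y j))).2
  simpa using h

theorem multiGSE_le_xiUpper {c : ℝ} (hc : 0 < c) : multiGSE S ≤ xiUpper S c := by
  refine mul_le_mul_of_nonneg_left ?_ (by positivity)
  have : IsProbabilityMeasure (gaussTensor p n) := by unfold gaussTensor; infer_instance
  have h1 := exp_integral_le_integral_exp ((integrable_multiMax hS hne).const_mul c)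
    (integrable_exp_multiMax hS hne c)
  rw [integral_const_mul] at h1
  have h2 := (mul_le_mul_of_nonneg_left h1 (Real.exp_pos _).le).trans
    (exp_mul_integral_exp_multiMax_le hS hne hc)
  rw [← Real.exp_add] at h2
  have h3 := (Real.le_log_iff_exp_le ((Real.exp_pos _).trans_le h2)).2 h2
  have h4 := mul_le_mul_of_nonneg_left h3 (one_div_pos.2 hc).le
  have h5 : 1 / c * (c ^ 2 * ((p : ℝ) - 1) / 2 + c * ∫ A, multiMax S A ∂gaussTensor p n)
      = c / 2 * ((p : ℝ) - 1) + ∫ A, multiMax S A ∂gaussTensor p n := by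
    field_simp
  linarith

end Models

/-! ### Bounds on the energies for fixed n. -/

section Energies

instance isProbabilityMeasure_gaussTensor (p n : ℕ) : IsProbabilityMeasure (gaussTensor p n) := by
  unfold gaussTensor; infer_instance

instance isProbabilityMeasure_gaussTensors (p n : ℕ) : IsProbabilityMeasure (gaussTensors p n) := by
  unfold gaussTensors; infer_instance

instance isProbabilityMeasure_gaussVector (n : ℕ) : IsProbabilityMeasure (gaussVector n) := by
  unfold gaussVector; infer_instance

instance isProbabilityMeasure_gaussVectors (p n : ℕ) : IsProbabilityMeasure (gaussVectors p n) := by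
  unfold gaussVectors; infer_instance

variable {p n : ℕ} {S : Fin p → Set (EuclideanSpace ℝ (Fin n))}
  {T : Set (EuclideanSpace ℝ (Fin n))}

theorem integrable_singleMax (hT : T ⊆ Metric.sphere 0 1) (hTne : T.Nonempty) :
    Integrable (singleMax (p := p) T) (gaussTensor p n) := by
  have := hTne.to_subtype
  rw [singleMax_eq_supForm]
  exact integrable_supForm (abs_singleCoef_le hT)

theorem integrable_exp_linearMax (hT : T ⊆ Metric.sphere 0 1) (hTne : T.Nonempty) (c : ℝ) :
    Integrable (fun g => Real.exp (c * linearMax T g)) (gaussVector n) := by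
  have := hTne.to_subtype
  rw [linearMax_eq_supForm]
  exact integrable_exp_mul_supForm (abs_linearCoef_le hT) c

theorem bddAbove_linear (hT : T ⊆ Metric.sphere 0 1) (g : Fin n → ℝ) :
    BddAbove ((fun x : EuclideanSpace ℝ (Fin n) => ∑ i, g i * x i) '' T) := by
  rw [Set.image_eq_range]
  exact bddAbove_linForms (abs_linearCoef_le hT) g

theorem bddAbove_single (hT : T ⊆ Metric.sphere 0 1) (A : (Fin p → Fin n) → ℝ) :
    BddAbove ((fun x : EuclideanSpace ℝ (Fin n) => tensorForm A fun _ => x) '' T) := by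
  rw [Set.image_eq_range]
  exact bddAbove_linForms (abs_singleCoef_le hT) A

theorem integral_exp_linearMax_eval (c : ℝ) (hT : T ⊆ Metric.sphere 0 1) (hTne : T.Nonempty)
    (j : Fin p) :
    Integrable (fun g => Real.exp (c * linearMax T (g j))) (gaussVectors p n) ∧
      ∫ g, Real.exp (c * linearMax T (g j)) ∂gaussVectors p n
        = ∫ g, Real.exp (c * linearMax T g) ∂gaussVector n := by
  have mp : MeasurePreserving (Function.eval j) (gaussVectors p n) (gaussVector n) :=
    measurePreserving_eval (fun _ : Fin p => gaussVector n) j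
  have hi := integrable_exp_linearMax hT hTne c
  refine ⟨mp.integrable_comp_of_integrable hi, ?_⟩
  rw [← mp.map_eq, integral_map mp.measurable.aemeasurable
    (by rw [mp.map_eq]; exact hi.aestronglyMeasurable)]

theorem integral_singleMax_eval (hT : T ⊆ Metric.sphere 0 1) (hTne : T.Nonempty) (j : Fin p) :
    Integrable (fun A => singleMax T (A j)) (gaussTensors p n) ∧
      ∫ A, singleMax T (A j) ∂gaussTensors p n = ∫ A, singleMax T A ∂gaussTensor p n := by
  have mp : MeasurePreserving (Function.eval j) (gaussTensors p n) (gaussTensor p n) :=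
    measurePreserving_eval (fun _ : Fin p => gaussTensor p n) j
  have hi := integrable_singleMax (p := p) hT hTne
  refine ⟨mp.integrable_comp_of_integrable hi, ?_⟩
  rw [← mp.map_eq, integral_map mp.measurable.aemeasurable
    (by rw [mp.map_eq]; exact hi.aestronglyMeasurable)]

variable (hS : ∀ j, S j ⊆ Metric.sphere 0 1) (hne : ∀ j, (S j).Nonempty)
include hS hne

theorem linearSumMax_eq_sum (g : Fin p → Fin n → ℝ) :
    linearSumMax S g = ∑ j, linearMax (S j) (g j) :=
  sSup_sum_pi S hne (fun j x => ∑ i, g j i * x i) fun j => bddAbove_linear (hS j) _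

theorem decoupledMax_eq_sum (A : Fin p → (Fin p → Fin n) → ℝ) :
    decoupledMax S A = ∑ j, singleMax (S j) (A j) :=
  sSup_sum_pi S hne (fun j x => tensorForm (A j) fun _ => x) fun j => bddAbove_single (hS j) _

/-- The maximum separates over j and the g^(j) are independent, so the exponential moment
factorises. -/
theorem log_integral_exp_linearSumMax (c : ℝ) :
    Real.log (∫ g, Real.exp (c * linearSumMax S g) ∂gaussVectors p n)
      = ∑ j, Real.log (∫ g, Real.exp (c * linearMax (S j) g) ∂gaussVector n) := by
  have h := integral_fintype_prod_eq_prod (μ := fun _ : Fin p => gaussVector n)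
    fun j g => Real.exp (c * linearMax (S j) g)
  simp only [linearSumMax_eq_sum hS hne, Finset.mul_sum, Real.exp_sum]
  refine (congrArg Real.log h).trans (Real.log_prod fun j _ => ?_)
  exact (integral_exp_pos (integrable_exp_linearMax (hS j) (hne j) c)).ne'

theorem xiUpper_eq_sum (c : ℝ) :
    xiUpper S c = 1 / √(n : ℝ) * (-(c / 2) * ((p : ℝ) - 1) + 1 / c * ∑ j, Real.log
      (∫ g, Real.exp (c * linearMax (S j) (g j)) ∂gaussVectors p n)) := by
  rw [xiUpper, log_integral_exp_linearSumMax hS hne]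
  simp only [(integral_exp_linearMax_eval c (hS _) (hne _) _).2]

theorem tendsto_xiLower :
    Tendsto (fun c => xiLower S c) (𝓝[>] 0) (𝓝 (xiLowerZero S)) := by
  have h := (tendsto_log_integral_exp (integrable_exp_mul_decoupledMax hS hne)).const_mul
    (1 / √(n : ℝ))
  have e : 1 / √(n : ℝ) * ∫ A, (√(p : ℝ))⁻¹ * decoupledMax S A ∂gaussTensors p n
      = xiLowerZero S := by
    rw [integral_const_mul, xiLowerZero, Real.sqrt_mul (Nat.cast_nonneg p)]
    simp only [one_div, mul_inv]
    ring
  rw [e] at h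
  exact h.congr fun c => (xiLower_eq S c).symm

/-- The comparison holds for log-moments at every c > 0; both sides tend to means as c → 0⁺. -/
theorem xiLowerZero_le_multiGSE (hp : Even p) (hp0 : 0 < p) : xiLowerZero S ≤ multiGSE S := by
  refine le_of_tendsto_of_tendsto (tendsto_xiLower hS hne)
    ((tendsto_log_integral_exp (integrable_exp_multiMax hS hne)).const_mul (1 / √(n : ℝ))) ?_
  refine eventually_nhdsWithin_of_forall fun c (hc : 0 < c) => ?_
  simp only
  rw [xiLower_eq]
  refine mul_le_mul_of_nonneg_left (mul_le_mul_of_nonneg_left ?_ (one_div_pos.2 hc).le)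
    (by positivity)
  exact Real.log_le_log (integral_exp_pos (integrable_exp_mul_decoupledMax hS hne c))
    (integral_exp_decoupledMax_le hS hne hp hp0 hc)

/-- Both log-moments, divided by their parameter, lie between the common mean m and m + (parameter)
· p. Hence the dependence on c is O(1/√n). -/
theorem xiUpper_sub_le {c c' : ℝ} (hc : 0 < c) (hc' : 0 < c') :
    xiUpper S c - xiUpper S c' ≤ 1 / √(n : ℝ) * ((c + c') * (p + 1)) := by
  rw [xiUpper, xiUpper, ← mul_sub]
  refine mul_le_mul_of_nonneg_left ?_ (by positivity)
  set m := ∫ g, linearSumMax S g ∂gaussVectors p n with hm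
  have h1 : 1 / c * Real.log (∫ g, Real.exp (c * linearSumMax S g) ∂gaussVectors p n)
      ≤ m + c * p := by
    have h := (Real.log_le_iff_le_exp (integral_exp_pos (integrable_exp_linearSumMax hS hne c))).2
      (integral_exp_linearSumMax_le hS hne hc)
    rw [one_div, inv_mul_le_iff₀ hc]
    refine h.trans (le_of_eq ?_)
    ring
  have h2 : m ≤ 1 / c' * Real.log (∫ g, Real.exp (c' * linearSumMax S g) ∂gaussVectors p n) := by
    have h := exp_integral_le_integral_exp ((integrable_linearSumMax hS hne).const_mul c')
      (integrable_exp_linearSumMax hS hne c')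
    rw [integral_const_mul] at h
    rw [one_div, le_inv_mul_iff₀ hc']
    exact (Real.le_log_iff_exp_le ((Real.exp_pos _).trans_le h)).2 h
  have hp : (0 : ℝ) ≤ p := Nat.cast_nonneg p
  nlinarith [mul_nonneg hc.le hp, mul_nonneg hc'.le hp]

end Energies

/-! ### Reduction of identical sets to the general case. -/

section Identical

variable {p n : ℕ} {S : Fin p → Set (EuclideanSpace ℝ (Fin n))}
  {T : Set (EuclideanSpace ℝ (Fin n))} (hS : ∀ j, S j ⊆ Metric.sphere 0 1)
  (hne : ∀ j, (S j).Nonempty) (hT : ∀ j, S j = T) (hp0 : 0 < p)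
include hS hne hT hp0

theorem xiLowerIdentical_eq : xiLowerIdentical p T = xiLowerZero S := by
  obtain rfl : S = fun _ => T := funext hT
  have hT1 := hS ⟨0, hp0⟩
  have hT2 := hne ⟨0, hp0⟩
  have hp' : (0 : ℝ) < √(p : ℝ) := Real.sqrt_pos.2 (Nat.cast_pos.2 hp0)
  have e : ∫ A, decoupledMax (fun _ => T) A ∂gaussTensors p n
      = p * ∫ A, singleMax T A ∂gaussTensor p n := by
    simp only [decoupledMax_eq_sum hS hne]
    rw [integral_finsetSum _ fun j _ => (integral_singleMax_eval hT1 hT2 j).1]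
    simp [(integral_singleMax_eval hT1 hT2 _).2]
  rw [xiLowerIdentical, xiLowerZero, e, Real.sqrt_mul (Nat.cast_nonneg p), ← mul_assoc]
  congr 1
  nth_rewrite 3 [← Real.mul_self_sqrt (Nat.cast_nonneg p : (0 : ℝ) ≤ p)]
  rw [one_div, mul_inv, div_eq_mul_inv]
  field_simp

/-- The p equal log-moments add up, and p/(√p c) = √p/c; the two families of bounds differ only by
rescaling the parameter. -/
theorem xiUpperIdentical_eq (c : ℝ) :
    xiUpperIdentical p T c = xiUpper S (√(p : ℝ) * c) := by
  obtain rfl : S = fun _ => T := funext hT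
  have hp' : (0 : ℝ) < √(p : ℝ) := Real.sqrt_pos.2 (Nat.cast_pos.2 hp0)
  rw [xiUpperIdentical, xiUpper, log_integral_exp_linearSumMax hS hne, mul_comm c √(p : ℝ)]
  simp only [Finset.sum_const, Finset.card_univ, Fintype.card_fin, nsmul_eq_mul]
  set l := Real.log (∫ g, Real.exp (√(p : ℝ) * c * linearMax T g) ∂gaussVector n)
  have h : 1 / (√(p : ℝ) * c) * (p * l) = √(p : ℝ) * (1 / c * l) := by
    nth_rewrite 2 [← Real.mul_self_sqrt (Nat.cast_nonneg p : (0 : ℝ) ≤ p)]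
    rw [one_div, mul_inv, one_div]
    field_simp
  rw [h]
  ring

end Identical

/-! ### Thermodynamic limits. -/

section Limits

/-- The O(1/√n) comparison makes U constant on (0, ∞), so any point, here 1, is a minimiser. -/
theorem exists_isLeast_of_tendsto {f : ℝ → ℕ → ℝ} {K : ℝ → ℝ → ℝ}
    (hf : ∀ c c', 0 < c → 0 < c' → ∀ n, 1 ≤ n → f c n - f c' n ≤ 1 / √(n : ℝ) * K c c')
    {e : ℕ → ℝ} (he : ∀ c, 0 < c → ∀ n, 1 ≤ n → e n ≤ f c n) {ξ : ℝ}
    (hξ : Tendsto e atTop (𝓝 ξ)) {U : ℝ → ℝ}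
    (hU : ∀ c, 0 < c → Tendsto (f c) atTop (𝓝 (U c))) :
    ∃ m, IsLeast (U '' Set.Ioi 0) m ∧ ξ ≤ m := by
  refine ⟨U 1, ⟨⟨1, Set.mem_Ioi.2 one_pos, rfl⟩, ?_⟩, le_of_tendsto_of_tendsto hξ (hU 1 one_pos)
    ((eventually_ge_atTop 1).mono fun n hn => he 1 one_pos n hn)⟩
  rintro _ ⟨c, hc, rfl⟩
  have h0 : Tendsto (fun n : ℕ => 1 / √(n : ℝ) * K 1 c) atTop (𝓝 (0 * K 1 c)) :=
    (tendsto_const_nhds.div_atTop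
      (Real.tendsto_sqrt_atTop.comp tendsto_natCast_atTop_atTop)).mul_const _
  rw [zero_mul] at h0
  have h := le_of_tendsto_of_tendsto ((hU 1 one_pos).sub (hU c hc)) h0
    ((eventually_ge_atTop 1).mono fun n hn => hf 1 c one_pos hc n hn)
  exact sub_nonpos.1 h

/-- Serves the scaling c√n, where the O(1/√n) comparison is lost and only an infimum is claimed. -/
theorem le_sInf_of_tendsto {f : ℝ → ℕ → ℝ} {e : ℕ → ℝ}
    (he : ∀ c, 0 < c → ∀ n, 1 ≤ n → e n ≤ f c n) {ξ : ℝ}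
    (hξ : Tendsto e atTop (𝓝 ξ)) {U : ℝ → ℝ}
    (hU : ∀ c, 0 < c → Tendsto (f c) atTop (𝓝 (U c))) : ξ ≤ sInf (U '' Set.Ioi 0) := by
  refine le_csInf (Set.nonempty_Ioi.image U) ?_
  rintro _ ⟨c, hc, rfl⟩
  exact le_of_tendsto_of_tendsto hξ (hU c hc)
    ((eventually_ge_atTop 1).mono fun n hn => he c hc n hn)

end Limits

/-! ### Assembly of the bounds. -/

theorem mainTheorem5 (p : ℕ) (hp : Even p) (hp0 : 0 < p)
    (S : (n : ℕ) → Fin p → Set (EuclideanSpace ℝ (Fin n)))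
    (hS : ∀ n, 1 ≤ n → ∀ j, S n j ⊆ Metric.sphere 0 1)
    (hne : ∀ n, 1 ≤ n → ∀ j, (S n j).Nonempty) :
    -- all expectations involved are finite
    (∀ n, 1 ≤ n →
      Integrable (multiMax (S n)) (gaussTensor p n) ∧
      Integrable (decoupledMax (S n)) (gaussTensors p n) ∧
      ∀ c : ℝ, 0 < c →
        Integrable (fun A => Real.exp ((√(p : ℝ))⁻¹ * c * decoupledMax (S n) A))
          (gaussTensors p n) ∧
        Integrable (fun g => Real.exp (c * linearSumMax (S n) g)) (gaussVectors p n) ∧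
        ∀ j, Integrable (fun g => Real.exp (c * linearMax (S n j) (g j))) (gaussVectors p n)) ∧
    -- second form of `ξ_u`
    (∀ n, 1 ≤ n → ∀ c : ℝ, 0 < c →
      xiUpper (S n) c = 1 / √(n : ℝ) * (-(c / 2) * ((p : ℝ) - 1)
        + 1 / c * ∑ j, Real.log
            (∫ g, Real.exp (c * linearMax (S n j) (g j)) ∂gaussVectors p n))) ∧
    -- `ξ_l(p; S̄, n, 0)` is the limit of `ξ_l(p; S̄, n, c)` as `c → 0⁺`
    (∀ n, 1 ≤ n → Tendsto (fun c => xiLower (S n) c) (𝓝[>] 0) (𝓝 (xiLowerZero (S n)))) ∧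
    -- the bounds for each `n`
    (∀ n, 1 ≤ n → xiLowerZero (S n) ≤ multiGSE (S n) ∧
      ∀ c : ℝ, 0 < c → multiGSE (S n) ≤ xiUpper (S n) c) ∧
    -- the bounds in the thermodynamic limit
    (∀ ξ : ℝ, Tendsto (fun n => multiGSE (S n)) atTop (𝓝 ξ) →
      (∀ L : ℝ, Tendsto (fun n => xiLowerZero (S n)) atTop (𝓝 L) → L ≤ ξ) ∧
      (∀ U : ℝ → ℝ,
        (∀ c : ℝ, 0 < c → Tendsto (fun n => xiUpper (S n) c) atTop (𝓝 (U c))) →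
        ∃ m, IsLeast (U '' Set.Ioi 0) m ∧ ξ ≤ m) ∧
      (∀ U : ℝ → ℝ,
        (∀ c : ℝ, 0 < c →
          Tendsto (fun n : ℕ => xiUpper (S n) (c * √(n : ℝ))) atTop (𝓝 (U c))) →
        ξ ≤ sInf (U '' Set.Ioi 0))) ∧
    -- identical sets
    (∀ T : (n : ℕ) → Set (EuclideanSpace ℝ (Fin n)), (∀ n, 1 ≤ n → ∀ j, S n j = T n) →
      (∀ n, 1 ≤ n →
        Integrable (singleMax (p := p) (T n)) (gaussTensor p n) ∧
        ∀ c : ℝ, 0 < c →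
          Integrable (fun g => Real.exp (c * √(p : ℝ) * linearMax (T n) g)) (gaussVector n)) ∧
      (∀ n, 1 ≤ n → xiLowerIdentical p (T n) ≤ multiGSE (S n) ∧
        ∀ c : ℝ, 0 < c → multiGSE (S n) ≤ xiUpperIdentical p (T n) c) ∧
      ∀ ξ : ℝ, Tendsto (fun n => multiGSE (S n)) atTop (𝓝 ξ) →
        (∀ L : ℝ, Tendsto (fun n => xiLowerIdentical p (T n)) atTop (𝓝 L) → L ≤ ξ) ∧
        (∀ s : ℝ, Tendsto (fun n => singleGSE p (T n)) atTop (𝓝 s) →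
          Tendsto (fun n => xiLowerIdentical p (T n)) atTop (𝓝 (√(p : ℝ) * s)) ∧
          √(p : ℝ) * s ≤ ξ) ∧
        (∀ U : ℝ → ℝ,
          (∀ c : ℝ, 0 < c →
            Tendsto (fun n => xiUpperIdentical p (T n) c) atTop (𝓝 (U c))) →
          ∃ m, IsLeast (U '' Set.Ioi 0) m ∧ ξ ≤ m) ∧
        (∀ U : ℝ → ℝ,
          (∀ c : ℝ, 0 < c →
            Tendsto (fun n : ℕ => xiUpperIdentical p (T n) (c * √(n : ℝ))) atTop (𝓝 (U c))) →
          ξ ≤ sInf (U '' Set.Ioi 0))) := by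
  have hsqrt : ∀ {c : ℝ}, 0 < c → ∀ n : ℕ, 1 ≤ n → 0 < c * √(n : ℝ) := fun hc n hn =>
    mul_pos hc (Real.sqrt_pos.2 (Nat.cast_pos.2 hn))
  have hpp : (0 : ℝ) < √(p : ℝ) := Real.sqrt_pos.2 (Nat.cast_pos.2 hp0)
  have hup : ∀ c : ℝ, 0 < c → ∀ n, 1 ≤ n → multiGSE (S n) ≤ xiUpper (S n) c := fun c hc n hn =>
    multiGSE_le_xiUpper (hS n hn) (hne n hn) hc
  have hlow : ∀ n, 1 ≤ n → xiLowerZero (S n) ≤ multiGSE (S n) := fun n hn =>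
    xiLowerZero_le_multiGSE (hS n hn) (hne n hn) hp hp0
  refine ⟨fun n hn => ⟨integrable_multiMax (hS n hn) (hne n hn),
      integrable_decoupledMax (hS n hn) (hne n hn) hp0, fun c _ => ⟨?_,
      integrable_exp_linearSumMax (hS n hn) (hne n hn) c,
      fun j => (integral_exp_linearMax_eval c (hS n hn j) (hne n hn j) j).1⟩⟩,
    fun n hn c _ => xiUpper_eq_sum (hS n hn) (hne n hn) c,
    fun n hn => tendsto_xiLower (hS n hn) (hne n hn),
    fun n hn => ⟨hlow n hn, fun c hc => hup c hc n hn⟩,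
    fun ξ hξ => ⟨fun L hL => ?_, fun U hU => ?_, fun U hU => ?_⟩, fun T hT => ?_⟩
  · simpa only [mul_assoc, mul_left_comm] using
      integrable_exp_mul_decoupledMax (hS n hn) (hne n hn) c
  · exact le_of_tendsto_of_tendsto hL hξ ((eventually_ge_atTop 1).mono hlow)
  · exact exists_isLeast_of_tendsto (f := fun c n => xiUpper (S n) c)
      (K := fun c c' => (c + c') * (p + 1)) (fun c c' hc hc' n hn =>
      xiUpper_sub_le (hS n hn) (hne n hn) hc hc') hup hξ hU
  · exact le_sInf_of_tendsto (f := fun c n => xiUpper (S n) (c * √(n : ℝ)))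
      (fun c hc n hn => hup _ (hsqrt hc n hn) n hn) hξ hU
  have hTS : ∀ n, 1 ≤ n → T n ⊆ Metric.sphere 0 1 := fun n hn => hT n hn ⟨0, hp0⟩ ▸ hS n hn _
  have hTne : ∀ n, 1 ≤ n → (T n).Nonempty := fun n hn => hT n hn ⟨0, hp0⟩ ▸ hne n hn _
  have eL : ∀ n, 1 ≤ n → xiLowerIdentical p (T n) = xiLowerZero (S n) := fun n hn =>
    xiLowerIdentical_eq (hS n hn) (hne n hn) (hT n hn) hp0
  have eU : ∀ n, 1 ≤ n → ∀ c, xiUpperIdentical p (T n) c = xiUpper (S n) (√(p : ℝ) * c) :=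
    fun n hn c => xiUpperIdentical_eq (hS n hn) (hne n hn) (hT n hn) hp0 c
  have hlowT : ∀ n, 1 ≤ n → xiLowerIdentical p (T n) ≤ multiGSE (S n) := fun n hn =>
    (eL n hn).trans_le (hlow n hn)
  have hupT : ∀ c : ℝ, 0 < c → ∀ n, 1 ≤ n → multiGSE (S n) ≤ xiUpperIdentical p (T n) c :=
    fun c hc n hn => (hup _ (mul_pos hpp hc) n hn).trans_eq (eU n hn c).symm
  refine ⟨fun n hn => ⟨integrable_singleMax (hTS n hn) (hTne n hn),
      fun c _ => integrable_exp_linearMax (hTS n hn) (hTne n hn) _⟩,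
    fun n hn => ⟨hlowT n hn, fun c hc => hupT c hc n hn⟩, fun ξ hξ => ?_⟩
  have hL : ∀ L : ℝ, Tendsto (fun n => xiLowerIdentical p (T n)) atTop (𝓝 L) → L ≤ ξ :=
    fun L hL => le_of_tendsto_of_tendsto hL hξ ((eventually_ge_atTop 1).mono hlowT)
  refine ⟨hL, fun s hs => ?_, fun U hU => ?_, fun U hU => ?_⟩
  · have h : Tendsto (fun n => xiLowerIdentical p (T n)) atTop (𝓝 (√(p : ℝ) * s)) := by
      refine (hs.const_mul √(p : ℝ)).congr fun n => ?_
      rw [xiLowerIdentical, singleGSE, ← mul_assoc, mul_one_div]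
    exact ⟨h, hL _ h⟩
  · exact exists_isLeast_of_tendsto (f := fun c n => xiUpperIdentical p (T n) c)
      -- The general constant evaluated at the rescaled parameters √p c and √p c'.
      (K := fun c c' => (√(p : ℝ) * c + √(p : ℝ) * c') * (p + 1))
      (fun c c' hc hc' n hn => by
        simp only [eU n hn]
        exact xiUpper_sub_le (hS n hn) (hne n hn) (mul_pos hpp hc) (mul_pos hpp hc')) hupT hξ hU
  · exact le_sInf_of_tendsto (f := fun c n => xiUpperIdentical p (T n) (c * √(n : ℝ)))
      (fun c hc n hn => hupT _ (hsqrt hc n hn) n hn) hξ hU
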